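/- Let $\mathscr H,\mathscr K$ be complex Hilbert spaces (not necessarily separable), let $(X,\Sigma_X)$ and $(Y,\Sigma_Y)$ be measurable spaces, and let $E:\Sigma_X\to\mathfrak B(\mathscr H)$ and $F:\Sigma_Y\to\mathfrak B(\mathscr K)$ be projection-valued measures. Write $E_{v,v}(\Gamma)=\langle v,E(\Gamma)v\rangle$ and $F_{w,w}(\Delta)=\langle w,F(\Delta)w\rangle$. Let $\mathfrak S_2(\mathscr K,\mathscr H)$ be the Hilbert space of Hilbert–Schmidt operators $\mathscr K\to\mathscr H$, let $\mathfrak S_1(\mathscr K,\mathscr H)\subset\mathfrak S_2(\mathscr K,\mathscr H)$ be the space of trace-class operators with norm $\|T\|_{\mathfrak S_1}=\operatorname{Tr}|T|$, and let $\mathcal G$ be the unique projection-valued measure on $X\times Y$ (with the product $\sigma$-algebra) with values in $\mathfrak B(\mathfrak S_2(\mathscr K,\mathscr H))$ such that $\mathcal G(\Gamma\times\Delta)T=E(\Gamma)\,T\,F(\Delta)$ for all $\Gamma\in\Sigma_X$, $\Delta\in\Sigma_Y$, $T\in\mathfrak S_2(\mathscr K,\mathscr H)$. A decomposition of a bounded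 measurable function $\phi:X\times Y\to\mathbb C$ consists of a finite positive measure space $(Z,\Sigma_Z,\nu)$ and bounded measurable functions $\alpha:X\times Z\to\mathbb C$, $\beta:Y\times Z\to\mathbb C$ such that $$\phi(x,y)=\int_Z\alpha(x,z)\beta(y,z)\,d\nu(z)\qquad\text{for }\mathcal G\text{-a.e. }(x,y)\in X\times Y .$$ Let $\mathfrak M$ be the set of ($\mathcal G$-a.e. equivalence classes of) bounded measurable functions $\phi$ that have a decomposition, and for $\phi\in\mathfrak M$ put $$\|\phi\|_{\mathfrak M}=\inf_{(Z,\Sigma_Z,\nu,\alpha,\beta)}\ \sup_{v\in\mathscr H,\,w\in\mathscr K}\int_Z\|\alpha(\cdot,z)\|_{L^\infty(E_{v,v})}\,\|\beta(\cdot,z)\|_{L^\infty(F_{w,w})}\,d\nu(z),$$ where the infimum is over all decompositions of $\phi$. **Theorem.** If $\phi\in\mathfrak M$, then the operator $\int_{X\times Y}\phi\,d\mathcal G$ on $\mathfrak S_2(\mathscr K,\mathscr H)$ maps trace-class operators to trace-class operators and is bounded as an operator $\mathfrak S_1(\mathscr K,\mathscr H)\to\mathfrak S_1(\mathscr K,\mathscr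 H)$, with norm $$\Big\|\int_{X\times Y}\phi\,d\mathcal G\Big\|_{\mathfrak S_1\to\mathfrak S_1}\le\|\phi\|_{\mathfrak M}.$$ -/

import Mathlib

open MeasureTheory Filter Topology
open scoped ENNReal

universe w u₁ u₂ u₃ u₄

namespace DOI

section StarProjection

variable {S : Type*} [NormedAddCommGroup S] [InnerProductSpace ℂ S] [CompleteSpace S]

theorem inner_proj {P : S →L[ℂ] S} (hP : IsStarProjection P) (v : S) :
    inner ℂ v (P v) = ((‖P v‖ ^ 2 : ℝ) : ℂ) := by
  have h2 : P (P v) = P v := congrArg (fun A : S →L[ℂ] S => A v) hP.isIdempotentElem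
  have h3 : inner ℂ v (P (P v)) = inner ℂ (P v) (P v) := by
    have := ContinuousLinearMap.adjoint_inner_left P (P v) v
    rw [← ContinuousLinearMap.star_eq_adjoint, hP.isSelfAdjoint.star_eq] at this
    exact this.symm
  rw [h2] at h3
  rw [h3, inner_self_eq_norm_sq_to_K]
  simp

theorem inner_proj_left {P : S →L[ℂ] S} (hP : IsStarProjection P) (v w : S) :
    inner ℂ (P v) w = inner ℂ v (P w) := by
  have := ContinuousLinearMap.adjoint_inner_left P w v
  rwa [← ContinuousLinearMap.star_eq_adjoint, hP.isSelfAdjoint.star_eq] at this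

theorem proj_ext {P Q : S →L[ℂ] S} (hP : IsStarProjection P) (hQ : IsStarProjection Q)
    (h : ∀ v, ‖P v‖ ^ 2 = ‖Q v‖ ^ 2) : P = Q := by
  have : (P : S →ₗ[ℂ] S) = Q := by
    rw [← ext_inner_map]
    intro v
    have h1 := inner_proj hP v
    have h2 := inner_proj hQ v
    rw [h v] at h1
    have h3 := h1.trans h2.symm
    change inner ℂ (P v) v = inner ℂ (Q v) v
    rw [← inner_conj_symm (P v) v, ← inner_conj_symm (Q v) v, h3]
  ext v
  exact congrArg (fun A : S →ₗ[ℂ] S => A v) this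

theorem norm_sq_add {P : S →L[ℂ] S} (hP : IsStarProjection P) (v : S) :
    ‖P v‖ ^ 2 + ‖(1 - P) v‖ ^ 2 = ‖v‖ ^ 2 := by
  have h1 := inner_proj hP v
  have h2 := inner_proj hP.one_sub v
  have h3 : inner ℂ v ((1 - P) v) = inner ℂ v v - inner ℂ v (P v) :=
    inner_sub_right _ _ _
  rw [h3, h1, inner_self_eq_norm_sq_to_K] at h2
  have : ((‖v‖ ^ 2 - ‖P v‖ ^ 2 : ℝ) : ℂ) = ((‖(1 - P) v‖ ^ 2 : ℝ) : ℂ) := by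
    rw [← h2]; push_cast; rfl
  have := Complex.ofReal_injective this
  linarith

theorem norm_proj_le {P : S →L[ℂ] S} (hP : IsStarProjection P) (v : S) : ‖P v‖ ^ 2 ≤ ‖v‖ ^ 2 := by
  have := norm_sq_add hP v
  nlinarith [sq_nonneg ‖(1 - P) v‖]

theorem mul_eq_zero_of_norm {P Q : S →L[ℂ] S} (hP : IsStarProjection P)
    (h : ∀ v, ‖P v‖ ^ 2 + ‖Q v‖ ^ 2 ≤ ‖v‖ ^ 2) : Q * P = 0 := by
  ext v
  have h2 : P (P v) = P v := congrArg (fun A : S →L[ℂ] S => A v) hP.isIdempotentElem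
  have := h (P v)
  rw [h2] at this
  have h0 : ‖Q (P v)‖ ^ 2 = 0 := le_antisymm (by linarith) (sq_nonneg _)
  simpa using h0

theorem isStarProjection_sum {ι : Type*} (P : ι → S →L[ℂ] S) (hP : ∀ i, IsStarProjection (P i))
    (ho : ∀ i j, i ≠ j → P i * P j = 0) (s : Finset ι) : IsStarProjection (∑ i ∈ s, P i) := by
  classical
  induction s using Finset.induction_on with
  | empty => simp
  | insert a s ha ih =>
    rw [Finset.sum_insert ha]
    refine (hP a).add ih ?_
    rw [Finset.mul_sum]
    exact Finset.sum_eq_zero fun i hi => ho _ _ (by rintro rfl; exact ha hi)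

theorem exists_hasSum_proj {ι : Type*} (P : ι → S →L[ℂ] S) (hP : ∀ i, IsStarProjection (P i))
    (ho : ∀ i j, i ≠ j → P i * P j = 0) :
    ∃ Q : S →L[ℂ] S, IsStarProjection Q ∧ ∀ v, HasSum (fun i => P i v) (Q v) := by
  classical
  have hs := isStarProjection_sum P hP ho
  have hr := fun s => isStarProjection_iff_eq_starProjection_range.1 (hs s)
  let U : Finset ι → Submodule ℂ S := fun s => (∑ i ∈ s, P i).range
  have : ∀ s, (U s).HasOrthogonalProjection := fun s => (hr s).1
  have hU : Monotone U := by
    intro s t hst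
    rintro _ ⟨v, rfl⟩
    refine ⟨(∑ i ∈ s, P i) v, ?_⟩
    have : (∑ i ∈ t, P i) * (∑ i ∈ s, P i) = ∑ i ∈ s, P i := by
      rw [Finset.mul_sum]
      refine Finset.sum_congr rfl fun i hi => ?_
      rw [Finset.sum_mul, Finset.sum_eq_single_of_mem i (hst hi)]
      · exact (hP i).isIdempotentElem
      · intro j _ hj
        exact ho j i hj
    exact congrArg (fun A : S →L[ℂ] S => A v) this
  refine ⟨(⨆ s, U s).topologicalClosure.starProjection, isStarProjection_starProjection, fun v => ?_⟩
  have := Submodule.starProjection_tendsto_closure_iSup U hU v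
  refine this.congr fun s => ?_
  rw [← (hr s).2]
  simp

theorem hasSum_norm_sq {ι : Type*} {P : ι → S →L[ℂ] S} (hP : ∀ i, IsStarProjection (P i))
    {Q : S →L[ℂ] S} (hQ : IsStarProjection Q) {v : S} (h : HasSum (fun i => P i v) (Q v)) :
    HasSum (fun i => ‖P i v‖ ^ 2) (‖Q v‖ ^ 2) := by
  have h1 := h.mapL (innerSL ℂ v)
  simp only [innerSL_apply_apply, inner_proj (hP _), inner_proj hQ] at h1
  exact_mod_cast h1

end StarProjection


/-- A projection-valued measure on `X` with values in the bounded operators on `H`: measurable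
sets are sent to orthogonal projections, `univ` to the identity, and the set function is countably
additive in the strong operator topology. Non-measurable sets get the value `0`. -/
structure PVM (X : Type*) [MeasurableSpace X] (H : Type*) [NormedAddCommGroup H]
    [InnerProductSpace ℂ H] [CompleteSpace H] where
  proj : Set X → H →L[ℂ] H
  isStarProjection : ∀ s, MeasurableSet s → IsStarProjection (proj s)
  proj_univ : proj Set.univ = 1
  hasSum_iUnion : ∀ f : ℕ → Set X, (∀ n, MeasurableSet (f n)) →
    Pairwise (Function.onFun Disjoint f) →
    ∀ v, HasSum (fun n => proj (f n) v) (proj (⋃ n, f n) v)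
  proj_not_measurable : ∀ s, ¬ MeasurableSet s → proj s = 0

namespace PVM

variable {X : Type*} [MeasurableSpace X] {H : Type*} [NormedAddCommGroup H]
  [InnerProductSpace ℂ H] [CompleteSpace H]

theorem ext_proj {E F : PVM X H} (h : ∀ s, MeasurableSet s → E.proj s = F.proj s) : E = F := by
  have : E.proj = F.proj := by
    funext s
    by_cases hs : MeasurableSet s
    · exact h s hs
    · rw [E.proj_not_measurable s hs, F.proj_not_measurable s hs]
  cases E; cases F; congr

theorem proj_empty (E : PVM X H) : E.proj ∅ = 0 := by
  ext v
  have h := (E.hasSum_iUnion (fun _ => ∅) (fun _ => .empty) (fun _ _ _ => by simp [Function.onFun])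
    v).summable
  simpa [summable_const_iff] using h

/-- The finite positive measure `E_{v,v}`, given by `E_{v,v}(s) = ⟪v, E(s) v⟫`. -/
noncomputable def measure (E : PVM X H) (v : H) : Measure X :=
  Measure.ofMeasurable (fun s _ => ENNReal.ofReal (inner ℂ v (E.proj s v)).re)
    (by simp [E.proj_empty])
    (by
      intro f hf hd
      have h1 := (E.hasSum_iUnion f hf hd v).mapL (innerSL ℂ v)
      have h2 := h1.mapL Complex.reCLM
      simp only [innerSL_apply_apply, Complex.reCLM_apply] at h2
      rw [← h2.tsum_eq, ENNReal.ofReal_tsum_of_nonneg _ h2.summable]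
      intro n
      rw [inner_proj (E.isStarProjection _ (hf n)), Complex.ofReal_re]
      positivity)

theorem measure_apply (E : PVM X H) (v : H) {s : Set X} (hs : MeasurableSet s) :
    E.measure v s = ENNReal.ofReal (‖E.proj s v‖ ^ 2) := by
  rw [measure, Measure.ofMeasurable_apply _ hs, inner_proj (E.isStarProjection _ hs),
    Complex.ofReal_re]

instance (E : PVM X H) (v : H) : IsFiniteMeasure (E.measure v) :=
  ⟨by rw [measure_apply _ _ .univ]; exact ENNReal.ofReal_lt_top⟩

theorem real_measure_apply (E : PVM X H) (v : H) {s : Set X} (hs : MeasurableSet s) :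
    (E.measure v).real s = ‖E.proj s v‖ ^ 2 := by
  rw [Measure.real, measure_apply _ _ hs, ENNReal.toReal_ofReal (by positivity)]

theorem proj_mul_of_disjoint (E : PVM X H) {s t : Set X} (hs : MeasurableSet s)
    (ht : MeasurableSet t) (h : Disjoint s t) : E.proj t * E.proj s = 0 := by
  refine mul_eq_zero_of_norm (E.isStarProjection s hs) fun v => ?_
  rw [← E.real_measure_apply v hs, ← E.real_measure_apply v ht, ← measureReal_union h ht]
  refine (measureReal_mono (Set.subset_univ _)).trans ?_
  rw [E.real_measure_apply v .univ, E.proj_univ]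
  simp

theorem proj_union (E : PVM X H) {s t : Set X} (hs : MeasurableSet s)
    (ht : MeasurableSet t) (h : Disjoint s t) : E.proj (s ∪ t) = E.proj s + E.proj t := by
  refine proj_ext (E.isStarProjection _ (hs.union ht)) ((E.isStarProjection s hs).add
    (E.isStarProjection t ht) (E.proj_mul_of_disjoint ht hs h.symm)) fun v => ?_
  have h0 : inner ℂ (E.proj s v) (E.proj t v) = 0 := by
    rw [inner_proj_left (E.isStarProjection s hs)]
    have : E.proj s (E.proj t v) = 0 := congrArg (fun A : H →L[ℂ] H => A v)
      (E.proj_mul_of_disjoint ht hs h.symm)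
    rw [this, inner_zero_right]
  have h1 := norm_add_sq_eq_norm_sq_add_norm_sq_of_inner_eq_zero _ _ h0
  rw [← E.real_measure_apply v (hs.union ht), measureReal_union h ht,
    E.real_measure_apply v hs, E.real_measure_apply v ht]
  simp only [add_apply]
  nlinarith

theorem proj_inter (E : PVM X H) {s t : Set X} (hs : MeasurableSet s)
    (ht : MeasurableSet t) : E.proj (s ∩ t) = E.proj s * E.proj t := by
  have h1 : E.proj s = E.proj (s ∩ t) + E.proj (s \ t) := by
    rw [← E.proj_union (hs.inter ht) (hs.diff ht) Set.disjoint_sdiff_inter.symm,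
      Set.inter_union_sdiff]
  have h2 : E.proj t = E.proj (s ∩ t) + E.proj (t \ s) := by
    rw [Set.inter_comm, ← E.proj_union (ht.inter hs) (ht.diff hs) Set.disjoint_sdiff_inter.symm,
      Set.inter_union_sdiff]
  rw [h1, h2, add_mul, mul_add, mul_add, (E.isStarProjection _ (hs.inter ht)).isIdempotentElem.eq,
    E.proj_mul_of_disjoint (ht.diff hs) (hs.inter ht)
      (Set.disjoint_left.2 fun x hx hx' => hx.2 hx'.1),
    E.proj_mul_of_disjoint (hs.inter ht) (hs.diff ht)
      (Set.disjoint_left.2 fun x hx hx' => hx'.2 hx.2),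
    E.proj_mul_of_disjoint (ht.diff hs) (hs.diff ht)
      (Set.disjoint_left.2 fun x hx hx' => hx.2 hx'.1)]
  simp

end PVM

section Extension

variable {S : Type*} [NormedAddCommGroup S] [InnerProductSpace ℂ S] [CompleteSpace S]
  {Ω : Type*} {𝒞 : Set (Set Ω)} {P : Set Ω → S →L[ℂ] S}

/-- The part of the identity left over after removing the projections of `f 0, …, f (n - 1)`. -/
noncomputable def remainderProj (P : Set Ω → S →L[ℂ] S) (f : ℕ → Set Ω) : ℕ → S →L[ℂ] S
  | 0 => 1
  | n + 1 => (1 - P (f n)) * remainderProj P f n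

theorem commute_remainder (hPi : ∀ A ∈ 𝒞, ∀ B ∈ 𝒞, P (A ∩ B) = P A * P B) {f : ℕ → Set Ω}
    (hf : ∀ n, f n ∈ 𝒞) {C : Set Ω} (hC : C ∈ 𝒞) (n : ℕ) :
    Commute (P C) (remainderProj P f n) := by
  have hc : ∀ n, Commute (P C) (P (f n)) := fun n => by
    rw [Commute, SemiconjBy, ← hPi C hC _ (hf n), ← hPi _ (hf n) C hC, Set.inter_comm]
  induction n with
  | zero => exact Commute.one_right _
  | succ n ih => exact ((Commute.one_right _).sub_right (hc n)).mul_right ih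

theorem remainder_step (hP : ∀ A ∈ 𝒞, IsStarProjection (P A))
    (hPi : ∀ A ∈ 𝒞, ∀ B ∈ 𝒞, P (A ∩ B) = P A * P B) {f : ℕ → Set Ω}
    (hf : ∀ n, f n ∈ 𝒞) {C : Set Ω} (hC : C ∈ 𝒞) (n : ℕ) (v : S) :
    ‖P C (remainderProj P f n v)‖ ^ 2 = ‖P (f n ∩ C) (remainderProj P f n v)‖ ^ 2
      + ‖P C (remainderProj P f (n + 1) v)‖ ^ 2 := by
  have h := norm_sq_add (hP _ (hf n)) (P C (remainderProj P f n v))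
  have h1 : P (f n) (P C (remainderProj P f n v)) = P (f n ∩ C) (remainderProj P f n v) := by
    rw [hPi _ (hf n) _ hC]; rfl
  have h2 : (1 - P (f n)) (P C (remainderProj P f n v)) = P C (remainderProj P f (n + 1) v) := by
    have : (1 - P (f n)) * P C = P C * (1 - P (f n)) := by
      rw [sub_mul, mul_sub, one_mul, mul_one, ← hPi _ (hf n) _ hC, ← hPi _ hC _ (hf n),
        Set.inter_comm]
    exact congrArg (fun A : S →L[ℂ] S => A (remainderProj P f n v)) this
  rw [h1, h2] at h
  exact h.symm

theorem norm_remainder_le (hP : ∀ A ∈ 𝒞, IsStarProjection (P A)) {f : ℕ → Set Ω}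
    (hf : ∀ n, f n ∈ 𝒞) (n : ℕ) (v : S) : ‖remainderProj P f n v‖ ^ 2 ≤ ‖v‖ ^ 2 := by
  induction n with
  | zero => simp [remainderProj]
  | succ n ih => exact (norm_proj_le (hP _ (hf n)).one_sub _).trans ih

theorem norm_sq_le_remainder (hP : ∀ A ∈ 𝒞, IsStarProjection (P A))
    (hPi : ∀ A ∈ 𝒞, ∀ B ∈ 𝒞, P (A ∩ B) = P A * P B) {f : ℕ → Set Ω}
    (hf : ∀ n, f n ∈ 𝒞) {C : Set Ω} (hC : C ∈ 𝒞) (n : ℕ) (v : S) :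
    ‖P C v‖ ^ 2 ≤ ‖P C (remainderProj P f n v)‖ ^ 2 + ∑ k ∈ Finset.range n, ‖P (f k) v‖ ^ 2 := by
  induction n with
  | zero => simp [remainderProj]
  | succ n ih =>
    rw [remainder_step hP hPi hf hC] at ih
    rw [Finset.sum_range_succ]
    have : ‖P (f n ∩ C) (remainderProj P f n v)‖ ^ 2 ≤ ‖P (f n) v‖ ^ 2 := by
      have h1 : P (f n ∩ C) (remainderProj P f n v) = P C (remainderProj P f n (P (f n) v)) := by
        have : P (f n ∩ C) * remainderProj P f n = P C * (remainderProj P f n * P (f n)) := by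
          rw [← (commute_remainder hPi hf (hf n) n).eq, ← mul_assoc, ← hPi _ hC _ (hf n),
            Set.inter_comm]
        exact congrArg (fun A : S →L[ℂ] S => A v) this
      rw [h1]
      exact (norm_proj_le (hP _ hC) _).trans (norm_remainder_le hP hf n _)
    linarith

variable [mΩ : MeasurableSpace Ω]

theorem measure_remainder (h𝒞 : IsSetSemiring 𝒞) (hmeas : ∀ A ∈ 𝒞, MeasurableSet A)
    (hP : ∀ A ∈ 𝒞, IsStarProjection (P A))
    (hPi : ∀ A ∈ 𝒞, ∀ B ∈ 𝒞, P (A ∩ B) = P A * P B) {R : S} {m : Measure Ω} [IsFiniteMeasure m]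
    (hm : ∀ A ∈ 𝒞, m.real A = ‖P A R‖ ^ 2) {f : ℕ → Set Ω} (hf : ∀ n, f n ∈ 𝒞) (n : ℕ) :
    ∀ C ∈ 𝒞, ‖P C (remainderProj P f n R)‖ ^ 2 = m.real (C \ ⋃ k ∈ Finset.range n, f k) := by
  induction n with
  | zero => intro C hC; simp [remainderProj, hm C hC]
  | succ n ih =>
    intro C hC
    have h1 := remainder_step hP hPi hf hC n R
    rw [ih C hC, ih _ (h𝒞.inter_mem _ (hf n) _ hC)] at h1
    have hU : MeasurableSet (⋃ k ∈ Finset.range n, f k) :=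
      Finset.measurableSet_biUnion _ fun k _ => hmeas _ (hf k)
    have h2 := measureReal_inter_add_sdiff (μ := m) (s := C \ ⋃ k ∈ Finset.range n, f k)
      (hmeas _ (hf n))
    have e1 : (C \ ⋃ k ∈ Finset.range n, f k) ∩ f n = (f n ∩ C) \ ⋃ k ∈ Finset.range n, f k := by
      ext x; simp only [Set.mem_inter_iff, Set.mem_sdiff]; tauto
    have e2 : (C \ ⋃ k ∈ Finset.range n, f k) \ f n = C \ ⋃ k ∈ Finset.range (n + 1), f k := by
      rw [Finset.range_add_one, Finset.set_biUnion_insert]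
      ext x; simp only [Set.mem_union, Set.mem_sdiff]; tauto
    rw [e1, e2] at h2
    linarith

theorem tendsto_remainder (h𝒞 : IsSetSemiring 𝒞) (hmeas : ∀ A ∈ 𝒞, MeasurableSet A)
    (hP : ∀ A ∈ 𝒞, IsStarProjection (P A))
    (hPi : ∀ A ∈ 𝒞, ∀ B ∈ 𝒞, P (A ∩ B) = P A * P B)
    {D : Set S} (hD : Dense (Submodule.span ℂ D : Set S))
    (hm : ∀ R ∈ D, ∃ m : Measure Ω, IsFiniteMeasure m ∧ ∀ A ∈ 𝒞, m.real A = ‖P A R‖ ^ 2)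
    {f : ℕ → Set Ω} (hf : ∀ n, f n ∈ 𝒞) {C : Set Ω} (hC : C ∈ 𝒞) (hCf : C ⊆ ⋃ n, f n) (T : S) :
    Tendsto (fun n => P C (remainderProj P f n T)) atTop (𝓝 0) := by
  have hle : ∀ n v, ‖P C (remainderProj P f n v)‖ ≤ ‖v‖ := fun n v =>
    (pow_le_pow_iff_left₀ (norm_nonneg _) (norm_nonneg _) two_ne_zero).1
      ((norm_proj_le (hP _ hC) _).trans (norm_remainder_le hP hf n v))
  have h1 : ∀ R ∈ Submodule.span ℂ D,
      Tendsto (fun n => P C (remainderProj P f n R)) atTop (𝓝 0) := by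
    intro R hR
    induction hR using Submodule.span_induction with
    | mem R hR =>
      obtain ⟨m, hfin, hm⟩ := hm R hR
      rw [tendsto_zero_iff_norm_tendsto_zero]
      have h2 : Tendsto (fun n => m.real (C \ ⋃ k ∈ Finset.range n, f k)) atTop (𝓝 0) := by
        have h3 := tendsto_measure_iInter_atTop (μ := m)
          (s := fun n => C \ ⋃ k ∈ Finset.range n, f k)
          (fun n => ((hmeas _ hC).diff
            (Finset.measurableSet_biUnion _ fun k _ => hmeas _ (hf k))).nullMeasurableSet)
          (fun a b hab => Set.sdiff_subset_sdiff_right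
            (Set.biUnion_subset_biUnion_left fun k hk => by
              simp only [Finset.coe_range, Set.mem_Iio] at hk ⊢
              exact lt_of_lt_of_le hk hab))
          ⟨0, measure_ne_top _ _⟩
        have h4 : ⋂ n, C \ ⋃ k ∈ Finset.range n, f k = ∅ := by
          refine Set.eq_empty_of_forall_notMem fun x hx => ?_
          rw [Set.mem_iInter] at hx
          obtain ⟨k, hk⟩ := Set.mem_iUnion.1 (hCf (hx 0).1)
          exact (hx (k + 1)).2 (Set.mem_biUnion (Finset.mem_range.2 (Nat.lt_succ_self k)) hk)
        rw [h4, measure_empty] at h3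
        exact (ENNReal.tendsto_toReal ENNReal.zero_ne_top).comp h3
      simp only [← measure_remainder h𝒞 hmeas hP hPi hm hf _ C hC] at h2
      have h5 := h2.sqrt
      simpa using h5
    | zero => simp
    | add x y _ _ hx hy => simpa using hx.add hy
    | smul a x _ hx => simpa using hx.const_smul a
  rw [Metric.tendsto_atTop]
  intro ε hε
  obtain ⟨R, hRT, hR⟩ := Metric.dense_iff.1 hD T (ε / 2) (by positivity)
  obtain ⟨N, hN⟩ := Metric.tendsto_atTop.1 (h1 R hR) (ε / 2) (by positivity)
  refine ⟨N, fun n hn => ?_⟩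
  have h2 := hN n hn
  have h3 := hle n (T - R)
  rw [Metric.mem_ball, dist_comm, dist_eq_norm] at hRT
  rw [dist_zero_right] at h2 ⊢
  have h4 : P C (remainderProj P f n T)
      = P C (remainderProj P f n (T - R)) + P C (remainderProj P f n R) := by
    rw [← map_add, ← map_add, sub_add_cancel]
  rw [h4]
  linarith [norm_add_le (P C (remainderProj P f n (T - R))) (P C (remainderProj P f n R))]

theorem proj_subadditive (h𝒞 : IsSetSemiring 𝒞) (hmeas : ∀ A ∈ 𝒞, MeasurableSet A)
    (hP : ∀ A ∈ 𝒞, IsStarProjection (P A))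
    (hPi : ∀ A ∈ 𝒞, ∀ B ∈ 𝒞, P (A ∩ B) = P A * P B)
    {D : Set S} (hD : Dense (Submodule.span ℂ D : Set S))
    (hm : ∀ R ∈ D, ∃ m : Measure Ω, IsFiniteMeasure m ∧ ∀ A ∈ 𝒞, m.real A = ‖P A R‖ ^ 2)
    {f : ℕ → Set Ω} (hf : ∀ n, f n ∈ 𝒞) {C : Set Ω} (hC : C ∈ 𝒞) (hCf : C ⊆ ⋃ n, f n) (T : S) :
    ENNReal.ofReal (‖P C T‖ ^ 2) ≤ ∑' n, ENNReal.ofReal (‖P (f n) T‖ ^ 2) := by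
  have h1 := (tendsto_remainder h𝒞 hmeas hP hPi hD hm hf hC hCf T).norm.pow 2
  have h2 := ENNReal.tendsto_ofReal h1
  have h3 := h2.add_const (∑' n, ENNReal.ofReal (‖P (f n) T‖ ^ 2))
  simp only [norm_zero, ne_eq, OfNat.ofNat_ne_zero, not_false_eq_true, zero_pow,
    ENNReal.ofReal_zero, zero_add] at h3
  refine ge_of_tendsto' h3 fun n => ?_
  refine (ENNReal.ofReal_le_ofReal (norm_sq_le_remainder hP hPi hf hC n T)).trans ?_
  rw [ENNReal.ofReal_add (by positivity) (by positivity),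
    ENNReal.ofReal_sum_of_nonneg fun _ _ => by positivity]
  gcongr
  exact ENNReal.sum_le_tsum _

theorem proj_additive (hP : ∀ A ∈ 𝒞, IsStarProjection (P A)) (hPe : P ∅ = 0)
    (hmeas : ∀ A ∈ 𝒞, MeasurableSet A)
    (hPi : ∀ A ∈ 𝒞, ∀ B ∈ 𝒞, P (A ∩ B) = P A * P B)
    {D : Set S} (hD : Dense (Submodule.span ℂ D : Set S))
    (hm : ∀ R ∈ D, ∃ m : Measure Ω, IsFiniteMeasure m ∧ ∀ A ∈ 𝒞, m.real A = ‖P A R‖ ^ 2)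
    (I : Finset (Set Ω)) (hI : ↑I ⊆ 𝒞) (hd : (I : Set (Set Ω)).PairwiseDisjoint id)
    (hU : ⋃₀ ↑I ∈ 𝒞) (T : S) :
    ‖P (⋃₀ ↑I) T‖ ^ 2 = ∑ u ∈ I, ‖P u T‖ ^ 2 := by
  have ho : ∀ i j : I, i ≠ j → P (i : Set Ω) * P (j : Set Ω) = 0 := fun i j hij => by
    rw [← hPi _ (hI i.2) _ (hI j.2), ← hPe]
    exact congrArg P (hd i.2 j.2 fun h => hij (Subtype.ext h)).inter_eq
  have hP' : ∀ i : I, IsStarProjection (P (i : Set Ω)) := fun i => hP _ (hI i.2)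
  have hQ := isStarProjection_sum (fun i : I => P (i : Set Ω)) hP' ho Finset.univ
  set Q := ∑ i : I, P (i : Set Ω) with hQdef
  have hQn : ∀ v, ‖Q v‖ ^ 2 = ∑ u ∈ I, ‖P u v‖ ^ 2 := by
    intro v
    have h1 : HasSum (fun i : I => P (i : Set Ω) v) (Q v) := by
      have := hasSum_fintype (fun i : I => P (i : Set Ω) v)
      rwa [show ∑ i : I, P (i : Set Ω) v = Q v by simp [hQdef]] at this
    have h2 := hasSum_norm_sq hP' hQ h1
    rw [h2.unique (hasSum_fintype _), Finset.sum_coe_sort I fun u => ‖P u v‖ ^ 2]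
  have hPQ : Q * P (⋃₀ ↑I) = Q := by
    rw [hQdef, Finset.sum_mul]
    refine Finset.sum_congr rfl fun i _ => ?_
    rw [← hPi _ (hI i.2) _ hU, Set.inter_eq_left.2 (Set.subset_sUnion_of_mem i.2)]
  have hEq : P (⋃₀ ↑I) = Q := by
    refine ContinuousLinearMap.ext_on hD fun R hR => ?_
    obtain ⟨m, hfin, hm⟩ := hm R hR
    have h1 := norm_sq_add hQ (P (⋃₀ ↑I) R)
    have h2 : Q (P (⋃₀ ↑I) R) = Q R := congrArg (fun A : S →L[ℂ] S => A R) hPQ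
    rw [h2, hQn, ← hm _ hU] at h1
    have h3 : m.real (⋃₀ ↑I) = ∑ u ∈ I, ‖P u R‖ ^ 2 := by
      rw [Set.sUnion_eq_biUnion]
      rw [show (⋃ i ∈ (I : Set (Set Ω)), i) = ⋃ i ∈ I, id i by simp]
      rw [measureReal_biUnion_finset hd (fun u hu => hmeas _ (hI hu))]
      exact Finset.sum_congr rfl fun u hu => hm _ (hI hu)
    rw [h3] at h1
    have h4 : ‖(1 - Q) (P (⋃₀ ↑I) R)‖ ^ 2 = 0 := by linarith
    have h5 : P (⋃₀ ↑I) R - Q (P (⋃₀ ↑I) R) = 0 := by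
      have := pow_eq_zero_iff (two_ne_zero) |>.1 h4
      exact norm_eq_zero.1 this
    rw [h2] at h5
    exact sub_eq_zero.1 h5
  rw [hEq, hQn]

/-- A multiplicative projection-valued function on a semiring of sets extends to a
projection-valued measure on the generated σ-algebra as soon as it is a measure on a total set of
vectors. -/
theorem exists_extension (h𝒞 : IsSetSemiring 𝒞) (hgen : mΩ = MeasurableSpace.generateFrom 𝒞)
    (hP : ∀ A ∈ 𝒞, IsStarProjection (P A)) (hPe : P ∅ = 0) (huniv : Set.univ ∈ 𝒞)
    (hPu : P Set.univ = 1)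
    (hPi : ∀ A ∈ 𝒞, ∀ B ∈ 𝒞, P (A ∩ B) = P A * P B)
    {D : Set S} (hD : Dense (Submodule.span ℂ D : Set S))
    (hm : ∀ R ∈ D, ∃ m : Measure Ω, IsFiniteMeasure m ∧ ∀ A ∈ 𝒞, m.real A = ‖P A R‖ ^ 2) :
    ∃ G : PVM Ω S, ∀ A ∈ 𝒞, G.proj A = P A := by
  classical
  have hmeas : ∀ A ∈ 𝒞, MeasurableSet A := fun A hA => by
    rw [hgen]; exact MeasurableSpace.measurableSet_generateFrom hA
  have hμ : ∀ T : S, ∃ μ : Measure Ω, ∀ A ∈ 𝒞, μ A = ENNReal.ofReal (‖P A T‖ ^ 2) := by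
    intro T
    let c : AddContent ℝ≥0∞ 𝒞 :=
      { toFun := fun A => ENNReal.ofReal (‖P A T‖ ^ 2)
        empty' := by simp [hPe]
        sUnion' := fun I hI hd hU => by
          rw [proj_additive hP hPe hmeas hPi hD hm I hI hd hU T,
            ENNReal.ofReal_sum_of_nonneg fun _ _ => by positivity] }
    have hc : c.IsSigmaSubadditive := fun f hf hU =>
      proj_subadditive h𝒞 hmeas hP hPi hD hm hf hU subset_rfl T
    exact ⟨c.measure h𝒞 hgen.le hc, fun A hA => c.measure_eq h𝒞 hgen hc hA⟩
  choose μ hμ using hμ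
  have hμu : ∀ T, μ T Set.univ = ENNReal.ofReal (‖T‖ ^ 2) := fun T => by
    rw [hμ T _ huniv, hPu]; rfl
  have hfin : ∀ T, IsFiniteMeasure (μ T) := fun T => ⟨by rw [hμu]; exact ENNReal.ofReal_lt_top⟩
  have horth : ∀ A B : Set Ω, MeasurableSet B → Disjoint A B → ∀ p q : S →L[ℂ] S,
      IsStarProjection p → (∀ T, (μ T).real A = ‖p T‖ ^ 2) → (∀ T, (μ T).real B = ‖q T‖ ^ 2) →
      q * p = 0 := by
    intro A B hB hAB p q hp hpA hqB
    refine mul_eq_zero_of_norm hp fun v => ?_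
    rw [← hpA, ← hqB, ← measureReal_union hAB hB]
    refine (measureReal_mono (Set.subset_univ _)).trans ?_
    rw [Measure.real, hμu, ENNReal.toReal_ofReal (by positivity)]
  have hunion : ∀ (f : ℕ → Set Ω) (p : ℕ → S →L[ℂ] S), Pairwise (Function.onFun Disjoint f) →
      (∀ n, MeasurableSet (f n)) → (∀ n, IsStarProjection (p n)) →
      (∀ n T, (μ T).real (f n) = ‖p n T‖ ^ 2) →
      ∃ q : S →L[ℂ] S, IsStarProjection q ∧ (∀ v, HasSum (fun n => p n v) (q v)) ∧
        ∀ T, (μ T).real (⋃ n, f n) = ‖q T‖ ^ 2 := by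
    intro f p hd hf hp hpf
    obtain ⟨q, hq, hs⟩ := exists_hasSum_proj p hp fun i j hij =>
      horth _ _ (hf i) (hd hij.symm) _ _ (hp j) (hpf j) (hpf i)
    refine ⟨q, hq, hs, fun T => ?_⟩
    have h1 := hasSum_norm_sq hp hq (hs T)
    simp only [← hpf] at h1
    rw [← h1.tsum_eq, measureReal_def, measure_iUnion hd hf, ENNReal.tsum_toReal_eq]
    · rfl
    · intro n; exact measure_ne_top _ _
  have hex : ∀ A, MeasurableSet A →
      ∃ p : S →L[ℂ] S, IsStarProjection p ∧ ∀ T, (μ T).real A = ‖p T‖ ^ 2 := by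
    intro A hA
    refine MeasurableSpace.induction_on_inter
      (C := fun A _ => ∃ p : S →L[ℂ] S, IsStarProjection p ∧ ∀ T, (μ T).real A = ‖p T‖ ^ 2)
      hgen h𝒞.isPiSystem ?_ ?_ ?_ ?_ A hA
    · exact ⟨0, by simp, by simp⟩
    · intro A hA
      exact ⟨P A, hP A hA, fun T => by
        rw [Measure.real, hμ T A hA, ENNReal.toReal_ofReal (by positivity)]⟩
    · rintro A hA ⟨p, hp, hpA⟩
      refine ⟨1 - p, hp.one_sub, fun T => ?_⟩
      have h1 := norm_sq_add hp T
      rw [measureReal_compl hA, hpA, Measure.real, hμu, ENNReal.toReal_ofReal (by positivity)]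
      linarith
    · intro f hd hf h
      choose p hp hpf using h
      obtain ⟨q, hq, -, hqf⟩ := hunion f p hd hf hp hpf
      exact ⟨q, hq, hqf⟩
  choose! g hg hgμ using hex
  refine ⟨⟨fun A => if MeasurableSet A then g A else 0, fun A hA => by simp [hA, hg A hA], ?_, ?_,
    fun A hA => by simp [hA]⟩, fun A hA => ?_⟩
  · rw [if_pos .univ]
    refine proj_ext (hg _ .univ) (.one _) fun v => ?_
    rw [← hgμ _ .univ, Measure.real, hμu, ENNReal.toReal_ofReal (sq_nonneg _), one_apply_eq_self]
  · intro f hf hd v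
    obtain ⟨q, hq, hs, hqf⟩ := hunion f (fun n => g (f n)) hd hf (fun n => hg _ (hf n))
      (fun n => hgμ _ (hf n))
    simp only [hf, MeasurableSet.iUnion hf, if_true]
    rw [show g (⋃ n, f n) = q from proj_ext (hg _ (.iUnion hf)) hq fun v => by
      rw [← hqf, hgμ _ (.iUnion hf)]]
    exact hs v
  · simp only [hmeas A hA, if_true]
    refine proj_ext (hg _ (hmeas A hA)) (hP A hA) fun v => ?_
    rw [← hgμ _ (hmeas A hA), Measure.real, hμ v A hA, ENNReal.toReal_ofReal (by positivity)]

end Extension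

section HilbertSchmidt

variable (K H : Type*) [NormedAddCommGroup K] [InnerProductSpace ℂ K] [CompleteSpace K]
  [NormedAddCommGroup H] [InnerProductSpace ℂ H] [CompleteSpace H]

/-- The index set of a fixed orthonormal basis of `K`. -/
def basisIndex : Set K := (exists_hilbertBasis ℂ K).choose

/-- A fixed orthonormal basis of `K`. The notions below do not depend on it
(`tsum_hilbertBasis_eq`). -/
noncomputable def stdBasis : HilbertBasis (basisIndex K) ℂ K :=
  (exists_hilbertBasis ℂ K).choose_spec.choose

variable {K H}

theorem tsum_enorm_inner_sq {ι : Type*} (b : HilbertBasis ι ℂ K) (x : K) :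
    ∑' i, ‖inner ℂ (b i) x‖ₑ ^ 2 = ‖x‖ₑ ^ 2 := by
  have h := (b.hasSum_inner_mul_inner x x).mapL Complex.reCLM
  have h1 : ∀ i, Complex.reCLM (inner ℂ x (b i) * inner ℂ (b i) x) = ‖inner ℂ (b i) x‖ ^ 2 := by
    intro i
    rw [← inner_conj_symm x (b i), mul_comm, Complex.mul_conj, Complex.normSq_eq_norm_sq,
      Complex.reCLM_apply, Complex.ofReal_re]
  simp only [h1] at h
  have h2 : Complex.reCLM (inner ℂ x x) = ‖x‖ ^ 2 := by
    rw [inner_self_eq_norm_sq_to_K, Complex.reCLM_apply]; norm_cast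
  rw [h2] at h
  have h3 : ∀ y : ℂ, ‖y‖ₑ ^ 2 = ENNReal.ofReal (‖y‖ ^ 2) := fun y => by
    rw [ENNReal.ofReal_pow (norm_nonneg _), ofReal_norm]
  simp only [h3]
  rw [← ENNReal.ofReal_tsum_of_nonneg (fun _ => by positivity) h.summable, h.tsum_eq,
    ENNReal.ofReal_pow (norm_nonneg _), ofReal_norm]

theorem tsum_adjoint {ι κ : Type*} (b : HilbertBasis ι ℂ K) (c : HilbertBasis κ ℂ H)
    (T : K →L[ℂ] H) :
    ∑' i, ‖T (b i)‖ₑ ^ 2 = ∑' j, ‖T.adjoint (c j)‖ₑ ^ 2 := by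
  simp only [← tsum_enorm_inner_sq c, ← tsum_enorm_inner_sq b (T.adjoint _)]
  rw [ENNReal.tsum_comm]
  refine tsum_congr fun j => tsum_congr fun i => ?_
  rw [ContinuousLinearMap.adjoint_inner_right, ← inner_conj_symm, RCLike.enorm_conj]

/-- The Hilbert–Schmidt norm does not depend on the orthonormal basis. -/
theorem tsum_hilbertBasis_eq {ι : Type*} (b : HilbertBasis ι ℂ K) (T : K →L[ℂ] H) :
    ∑' i, ‖T (b i)‖ₑ ^ 2 = ∑' i, ‖T (stdBasis K i)‖ₑ ^ 2 := by
  rw [tsum_adjoint b (stdBasis H), tsum_adjoint (stdBasis K) (stdBasis H)]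

/-- `T` is Hilbert–Schmidt: `∑ ‖T eᵢ‖² < ∞` for an orthonormal basis `(eᵢ)`. -/
def IsHilbertSchmidt (T : K →L[ℂ] H) : Prop :=
  Summable fun i => ‖T (stdBasis K i)‖ ^ 2

theorem isHilbertSchmidt_iff {T : K →L[ℂ] H} :
    IsHilbertSchmidt T ↔ ∑' i, ‖T (stdBasis K i)‖ₑ ^ 2 ≠ ⊤ := by
  have h3 : ∀ i, ‖T (stdBasis K i)‖ₑ ^ 2 = ((‖T (stdBasis K i)‖₊ ^ 2 : NNReal) : ℝ≥0∞) :=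
    fun i => by rw [ENNReal.coe_pow]; rfl
  simp only [h3]
  rw [ENNReal.tsum_coe_ne_top_iff_summable, ← NNReal.summable_coe]
  simp [IsHilbertSchmidt]

theorem isHilbertSchmidt_iff_memℓp {T : K →L[ℂ] H} :
    IsHilbertSchmidt T ↔ Memℓp (fun i => T (stdBasis K i)) 2 := by
  rw [memℓp_gen_iff (by simp)]
  simp [IsHilbertSchmidt]

theorem IsHilbertSchmidt.left {T : K →L[ℂ] H} (hT : IsHilbertSchmidt T) (A : H →L[ℂ] H) :
    IsHilbertSchmidt (A ∘L T) := by
  refine Summable.of_nonneg_of_le (fun _ => by positivity) (fun i => ?_) (hT.mul_left (‖A‖ ^ 2))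
  rw [← mul_pow]
  gcongr
  exact A.le_opNorm _

theorem IsHilbertSchmidt.adjoint {T : K →L[ℂ] H} (hT : IsHilbertSchmidt T) :
    IsHilbertSchmidt T.adjoint := by
  rw [isHilbertSchmidt_iff] at hT ⊢
  rwa [← tsum_adjoint (stdBasis K) (stdBasis H)]

theorem IsHilbertSchmidt.right {T : K →L[ℂ] H} (hT : IsHilbertSchmidt T) (B : K →L[ℂ] K) :
    IsHilbertSchmidt (T ∘L B) := by
  have := (hT.adjoint.left B.adjoint).adjoint
  rwa [ContinuousLinearMap.adjoint_comp, ContinuousLinearMap.adjoint_adjoint,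
    ContinuousLinearMap.adjoint_adjoint] at this

variable (K H) in
/-- The Hilbert–Schmidt operators as a subspace of the bounded operators. -/
noncomputable def hsSubmodule : Submodule ℂ (K →L[ℂ] H) where
  carrier := {T | IsHilbertSchmidt T}
  zero_mem' := by simp [IsHilbertSchmidt, summable_zero]
  add_mem' := fun {S T} hS hT => by
    rw [Set.mem_ofPred_eq, isHilbertSchmidt_iff_memℓp] at *
    exact hS.add hT
  smul_mem' := fun c T hT => by
    rw [Set.mem_ofPred_eq, isHilbertSchmidt_iff_memℓp] at *
    exact hT.const_smul c

variable (K H) in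
/-- The space `𝔖₂(K, H)` of Hilbert–Schmidt operators `K → H`, with the Hilbert–Schmidt inner
product (not the operator norm). -/
def HS : Type _ := hsSubmodule K H

noncomputable instance : AddCommGroup (HS K H) := inferInstanceAs (AddCommGroup (hsSubmodule K H))
noncomputable instance : Module ℂ (HS K H) := inferInstanceAs (Module ℂ (hsSubmodule K H))

/-- The bounded operator underlying a Hilbert–Schmidt operator. -/
noncomputable def HS.op : HS K H →ₗ[ℂ] (K →L[ℂ] H) := (hsSubmodule K H).subtype

/-- A Hilbert–Schmidt bounded operator as an element of `𝔖₂(K, H)`. -/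
def HS.mk (T : K →L[ℂ] H) (hT : IsHilbertSchmidt T) : HS K H := ⟨T, hT⟩

@[simp] theorem HS.op_mk (T : K →L[ℂ] H) (hT : IsHilbertSchmidt T) : (HS.mk T hT).op = T := rfl

theorem HS.isHilbertSchmidt (T : HS K H) : IsHilbertSchmidt T.op := T.2

theorem HS.op_injective : Function.Injective (HS.op : HS K H → K →L[ℂ] H) :=
  Subtype.val_injective

/-- `T ↦ (T eᵢ)ᵢ` as a map to `ℓ²`. -/
noncomputable def HS.toLp : HS K H →ₗ[ℂ] lp (fun _ : basisIndex K => H) 2 where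
  toFun T := ⟨fun i => T.op (stdBasis K i), isHilbertSchmidt_iff_memℓp.1 T.isHilbertSchmidt⟩
  map_add' S T := by ext i; simp only [map_add]; rfl
  map_smul' c T := by ext i; simp only [map_smul]; rfl

@[simp] theorem HS.toLp_apply (T : HS K H) (i : basisIndex K) :
    HS.toLp T i = T.op (stdBasis K i) := rfl

theorem op_ext_basis {S T : K →L[ℂ] H} (h : ∀ i, S (stdBasis K i) = T (stdBasis K i)) : S = T := by
  refine ContinuousLinearMap.ext_on
    (Submodule.dense_iff_topologicalClosure_eq_top.2 (stdBasis K).dense_span) ?_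
  rintro _ ⟨i, rfl⟩
  exact h i

theorem HS.toLp_injective : Function.Injective (HS.toLp : HS K H → _) := by
  intro S T h
  refine HS.op_injective (op_ext_basis fun i => ?_)
  rw [← HS.toLp_apply, ← HS.toLp_apply, h]

noncomputable instance : NormedAddCommGroup (HS K H) :=
  NormedAddCommGroup.induced _ _ HS.toLp HS.toLp_injective

theorem HS.norm_toLp (T : HS K H) : ‖HS.toLp T‖ = ‖T‖ := rfl

/-- The Hilbert–Schmidt inner product `⟪S, T⟫ = Tr (S* T) = ∑ ⟪S eᵢ, T eᵢ⟫`. -/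
noncomputable instance : InnerProductSpace ℂ (HS K H) where
  norm_smul_le c T := by rw [← HS.norm_toLp, ← HS.norm_toLp, map_smul, norm_smul]
  inner S T := ∑' i, inner ℂ (S.op (stdBasis K i)) (T.op (stdBasis K i))
  norm_sq_eq_re_inner T := by
    have := norm_sq_eq_re_inner (𝕜 := ℂ) (HS.toLp T)
    rwa [lp.inner_eq_tsum] at this
  conj_inner_symm S T := by
    have := inner_conj_symm (𝕜 := ℂ) (HS.toLp S) (HS.toLp T)
    rwa [lp.inner_eq_tsum, lp.inner_eq_tsum] at this
  add_left R S T := by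
    have := inner_add_left (𝕜 := ℂ) (HS.toLp R) (HS.toLp S) (HS.toLp T)
    rwa [← map_add, lp.inner_eq_tsum, lp.inner_eq_tsum, lp.inner_eq_tsum] at this
  smul_left S T c := by
    have := inner_smul_left (𝕜 := ℂ) (HS.toLp S) (HS.toLp T) c
    rwa [← map_smul, lp.inner_eq_tsum, lp.inner_eq_tsum] at this

theorem HS.inner_toLp (S T : HS K H) : inner ℂ (HS.toLp S) (HS.toLp T) = inner ℂ S T :=
  lp.inner_eq_tsum _ _

theorem HS.enorm_sq (T : HS K H) : ‖T‖ₑ ^ 2 = ∑' i, ‖T.op (stdBasis K i)‖ₑ ^ 2 := by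
  have h := lp.norm_rpow_eq_tsum (p := 2) (by simp) (HS.toLp T)
  simp only [ENNReal.toReal_ofNat, Real.rpow_two, HS.norm_toLp, HS.toLp_apply] at h
  have h3 : ∀ {E : Type _} [NormedAddCommGroup E] (y : E), ‖y‖ₑ ^ 2 = ENNReal.ofReal (‖y‖ ^ 2) :=
    fun y => by rw [ENNReal.ofReal_pow (norm_nonneg _), ofReal_norm]
  rw [h3, h, ENNReal.ofReal_tsum_of_nonneg (fun _ => by positivity) T.isHilbertSchmidt]
  exact tsum_congr fun i => (by rw [ENNReal.ofReal_pow (norm_nonneg _), ofReal_norm])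

theorem HS.enorm_apply_le (T : HS K H) (x : K) : ‖T.op x‖ₑ ≤ ‖T‖ₑ * ‖x‖ₑ := by
  refine (ENNReal.pow_le_pow_left_iff two_ne_zero).1 ?_
  rw [mul_pow, HS.enorm_sq, tsum_adjoint _ (stdBasis H), ← ENNReal.tsum_mul_right,
    ← tsum_enorm_inner_sq (stdBasis H)]
  refine ENNReal.tsum_le_tsum fun j => ?_
  rw [← mul_pow, ← ContinuousLinearMap.adjoint_inner_left]
  gcongr
  rw [← ofReal_norm, ← ofReal_norm, ← ofReal_norm, ← ENNReal.ofReal_mul (norm_nonneg _)]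
  exact ENNReal.ofReal_le_ofReal (norm_inner_le_norm _ _)

theorem HS.norm_op_le (T : HS K H) : ‖T.op‖ ≤ ‖T‖ := by
  refine ContinuousLinearMap.opNorm_le_bound _ (norm_nonneg _) fun x => ?_
  have := HS.enorm_apply_le T x
  rw [← ofReal_norm, ← ofReal_norm, ← ofReal_norm, ← ENNReal.ofReal_mul (norm_nonneg _)] at this
  exact (ENNReal.ofReal_le_ofReal_iff (by positivity)).1 this

instance : CompleteSpace (HS K H) := by
  refine Metric.complete_of_cauchySeq_tendsto fun u hu => ?_
  have h1 : CauchySeq fun n => HS.toLp (u n) := by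
    rw [Metric.cauchySeq_iff] at hu ⊢
    intro ε hε
    obtain ⟨N, hN⟩ := hu ε hε
    refine ⟨N, fun m hm n hn => ?_⟩
    have := hN m hm n hn
    rwa [dist_eq_norm, ← HS.norm_toLp, map_sub, ← dist_eq_norm] at this
  have h2 : CauchySeq fun n => (u n).op := by
    rw [Metric.cauchySeq_iff] at hu ⊢
    intro ε hε
    obtain ⟨N, hN⟩ := hu ε hε
    refine ⟨N, fun m hm n hn => ?_⟩
    have := hN m hm n hn
    rw [dist_eq_norm] at this ⊢
    rw [← map_sub]
    exact (HS.norm_op_le _).trans_lt this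
  obtain ⟨f, hf⟩ := cauchySeq_tendsto_of_complete h1
  obtain ⟨T, hT⟩ := cauchySeq_tendsto_of_complete h2
  have h3 : ∀ i, f i = T (stdBasis K i) := by
    intro i
    have e1 : Tendsto (fun n => HS.toLp (u n) i) atTop (𝓝 (f i)) := by
      rw [tendsto_iff_norm_sub_tendsto_zero] at hf ⊢
      exact squeeze_zero (fun _ => norm_nonneg _)
        (fun n => lp.norm_apply_le_norm two_ne_zero (HS.toLp (u n) - f) i) hf
    have e2 : Tendsto (fun n => (u n).op (stdBasis K i)) atTop (𝓝 (T (stdBasis K i))) :=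
      ((ContinuousLinearMap.apply ℂ H (stdBasis K i)).continuous.tendsto T).comp hT
    exact tendsto_nhds_unique e1 e2
  have h4 : IsHilbertSchmidt T := by
    rw [isHilbertSchmidt_iff_memℓp, ← funext h3]
    exact f.2
  refine ⟨HS.mk T h4, ?_⟩
  rw [tendsto_iff_norm_sub_tendsto_zero] at hf ⊢
  refine hf.congr fun n => ?_
  rw [← HS.norm_toLp, map_sub]
  congr 2
  ext i
  exact h3 i

end HilbertSchmidt

section Integral

variable {H : Type*} [NormedAddCommGroup H] [InnerProductSpace ℂ H] [CompleteSpace H]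

theorem exists_weak_limit (A : ℕ → H →L[ℂ] H) (q : H → ℂ) (C : ℝ)
    (h : ∀ v, Tendsto (fun n => inner ℂ v (A n v)) atTop (𝓝 (q v)))
    (hC : ∀ v, ‖q v‖ ≤ C * ‖v‖ ^ 2) : ∃ B : H →L[ℂ] H, ∀ v, inner ℂ v (B v) = q v := by
  have hp : ∀ v, Tendsto (fun n => inner ℂ (A n v) v) atTop (𝓝 (starRingEnd ℂ (q v))) := by
    intro v
    have := (Complex.continuous_conj.tendsto _).comp (h v)
    refine this.congr fun n => ?_
    exact inner_conj_symm _ _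
  set p : H → ℂ := fun v => starRingEnd ℂ (q v)
  have hpC : ∀ v, ‖p v‖ ≤ C * ‖v‖ ^ 2 := fun v => by simpa [p] using hC v
  have hC0 : ∀ v : H, 0 ≤ C * ‖v‖ ^ 2 := fun v => (norm_nonneg _).trans (hC v)
  let β : H → H → ℂ := fun y x => (p (x + y) - p (x - y) + Complex.I * p (x + Complex.I • y)
    - Complex.I * p (x - Complex.I • y)) / 4
  have hβ : ∀ y x, Tendsto (fun n => inner ℂ (A n y) x) atTop (𝓝 (β y x)) := by
    intro y x
    have := ((((hp (x + y)).sub (hp (x - y))).add ((hp (x + Complex.I • y)).const_mul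
      Complex.I)).sub ((hp (x - Complex.I • y)).const_mul Complex.I)).div_const 4
    refine this.congr fun n => ?_
    exact (inner_map_polarization (A n : H →ₗ[ℂ] H) x y).symm
  have hbd : ∀ y x, ‖β y x‖ ≤ C * (‖x‖ ^ 2 + ‖y‖ ^ 2) := by
    intro y x
    have h1 := parallelogram_law_with_norm ℂ x y
    have h2 := parallelogram_law_with_norm ℂ x (Complex.I • y)
    have h3 : ‖Complex.I • y‖ = ‖y‖ := by simp [norm_smul]
    rw [h3] at h2
    have e : ‖β y x‖ ≤ (‖p (x + y)‖ + ‖p (x - y)‖ + ‖p (x + Complex.I • y)‖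
        + ‖p (x - Complex.I • y)‖) / 4 := by
      simp only [β, norm_div]
      rw [show ‖(4 : ℂ)‖ = 4 by simp]
      gcongr
      refine (norm_sub_le _ _).trans ?_
      rw [norm_mul, Complex.norm_I, one_mul]
      gcongr
      refine (norm_add_le _ _).trans ?_
      rw [norm_mul, Complex.norm_I, one_mul]
      gcongr
      exact norm_sub_le _ _
    have a1 := hpC (x + y)
    have a2 := hpC (x - y)
    have a3 := hpC (x + Complex.I • y)
    have a4 := hpC (x - Complex.I • y)
    have : C * ‖x + y‖ ^ 2 + C * ‖x - y‖ ^ 2 + C * ‖x + Complex.I • y‖ ^ 2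
      + C * ‖x - Complex.I • y‖ ^ 2 = 4 * (C * (‖x‖ ^ 2 + ‖y‖ ^ 2)) := by
      linear_combination C * h1 + C * h2
    linarith
  let L : H →ₗ⋆[ℂ] H →ₗ[ℂ] ℂ := LinearMap.mk₂'ₛₗ (starRingEnd ℂ) (RingHom.id ℂ) β
    (fun y y' x => tendsto_nhds_unique (hβ _ _) (((hβ y x).add (hβ y' x)).congr fun n => by
      rw [map_add, inner_add_left]))
    (fun c y x => tendsto_nhds_unique (hβ _ _) (((hβ y x).const_mul (starRingEnd ℂ c)).congr
      fun n => by rw [map_smul, inner_smul_left]))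
    (fun y x x' => tendsto_nhds_unique (hβ _ _) (((hβ y x).add (hβ y x')).congr fun n => by
      rw [inner_add_right]))
    (fun c y x => tendsto_nhds_unique (hβ _ _) (((hβ y x).const_mul c).congr fun n => by
      rw [inner_smul_right]))
  have hL : ∀ y x, ‖L y x‖ ≤ 2 * C * ‖y‖ * ‖x‖ := by
    intro y x
    by_cases hy : y = 0
    · simp [hy]
    by_cases hx : x = 0
    · simp [hx]
    have h1 := hbd (((‖y‖⁻¹ : ℝ) : ℂ) • y) (((‖x‖⁻¹ : ℝ) : ℂ) • x)
    change ‖L _ _‖ ≤ _ at h1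
    have hy' : ‖y‖ ≠ 0 := norm_ne_zero_iff.2 hy
    have hx' : ‖x‖ ≠ 0 := norm_ne_zero_iff.2 hx
    have n1 : ‖((‖y‖⁻¹ : ℝ) : ℂ)‖ = ‖y‖⁻¹ := by simp
    have n2 : ‖((‖x‖⁻¹ : ℝ) : ℂ)‖ = ‖x‖⁻¹ := by simp
    have e1 : L (((‖y‖⁻¹ : ℝ) : ℂ) • y) (((‖x‖⁻¹ : ℝ) : ℂ) • x)
        = starRingEnd ℂ ((‖y‖⁻¹ : ℝ) : ℂ) * (((‖x‖⁻¹ : ℝ) : ℂ) * L y x) := by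
      rw [LinearMap.map_smulₛₗ₂, map_smul, smul_eq_mul, smul_eq_mul]
    rw [e1, norm_smul, norm_smul, norm_mul, norm_mul, RCLike.norm_conj, n1, n2,
      inv_mul_cancel₀ hy', inv_mul_cancel₀ hx'] at h1
    have h2 := mul_le_mul_of_nonneg_right h1 (mul_nonneg (norm_nonneg y) (norm_nonneg x))
    have h3 : ‖y‖⁻¹ * (‖x‖⁻¹ * ‖L y x‖) * (‖y‖ * ‖x‖) = ‖L y x‖ := by field_simp
    rw [h3] at h2
    linarith
  refine ⟨InnerProductSpace.continuousLinearMapOfBilin (L.mkContinuous₂ (2 * C) hL), fun v => ?_⟩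
  have h1 := InnerProductSpace.continuousLinearMapOfBilin_apply (L.mkContinuous₂ (2 * C) hL) v v
  have h2 : (L.mkContinuous₂ (2 * C) hL) v v = p v :=
    tendsto_nhds_unique (hβ v v) (hp v)
  rw [h2] at h1
  rw [← inner_conj_symm, h1]
  exact Complex.conj_conj _

variable {X : Type*} [MeasurableSpace X]

namespace PVM

theorem measure_real_univ (E : PVM X H) (v : H) : (E.measure v).real Set.univ = ‖v‖ ^ 2 := by
  rw [E.real_measure_apply v .univ, E.proj_univ, one_apply_eq_self]

/-- The integral of a bounded measurable function against a projection-valued measure exists. -/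
theorem exists_integral (E : PVM X H) {φ : X → ℂ} (hφ : Measurable φ)
    (hb : ∃ C : ℝ, ∀ x, ‖φ x‖ ≤ C) :
    ∃ A : H →L[ℂ] H, ∀ v, inner ℂ v (A v) = ∫ x, φ x ∂(E.measure v) := by
  obtain ⟨C, hC⟩ := hb
  let f : ℕ → SimpleFunc X ℂ := fun n => SimpleFunc.approxOn φ hφ Set.univ 0 (Set.mem_univ 0) n
  let A : ℕ → H →L[ℂ] H := fun n => ∑ c ∈ (f n).range, c • E.proj (f n ⁻¹' {c})
  have hA : ∀ n v, inner ℂ v (A n v) = ∫ x, f n x ∂(E.measure v) := by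
    intro n v
    rw [← SimpleFunc.integral_eq_integral _ (SimpleFunc.integrable_of_isFiniteMeasure _),
      SimpleFunc.integral_eq_sum_filter, Finset.sum_filter]
    simp only [A, sum_apply, smul_apply, inner_sum,
      inner_smul_right]
    refine Finset.sum_congr rfl fun c _ => ?_
    rw [inner_proj (E.isStarProjection _ ((f n).measurableSet_fiber c)),
      E.real_measure_apply v ((f n).measurableSet_fiber c)]
    by_cases hc : c = 0
    · simp [hc]
    · simp [hc, mul_comm]
  refine exists_weak_limit A (fun v => ∫ x, φ x ∂(E.measure v)) C (fun v => ?_) fun v => ?_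
  · simp only [hA]
    refine tendsto_integral_of_dominated_convergence (fun _ => C + C)
      (fun n => (f n).aestronglyMeasurable) (integrable_const _) (fun n => ?_) ?_
    · exact Eventually.of_forall fun x => (SimpleFunc.norm_approxOn_zero_le hφ (Set.mem_univ 0) x n).trans
        (add_le_add (hC x) (hC x))
    · exact Eventually.of_forall fun x => SimpleFunc.tendsto_approxOn hφ (Set.mem_univ 0) (by simp)
  · refine (norm_integral_le_of_norm_le_const (Eventually.of_forall hC)).trans ?_
    rw [E.measure_real_univ]

open Classical in
/-- The operator `∫ φ dE`, for a bounded measurable function `φ`: the bounded operator with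
`⟪v, (∫ φ dE) v⟫ = ∫ φ dE_{v,v}` for all `v` (unique by polarization). For other functions `φ` the
value is `0`. -/
noncomputable def integral (E : PVM X H) (φ : X → ℂ) : H →L[ℂ] H :=
  if h : Measurable φ ∧ ∃ C : ℝ, ∀ x, ‖φ x‖ ≤ C then (E.exists_integral h.1 h.2).choose else 0

theorem inner_integral (E : PVM X H) {φ : X → ℂ} (hφ : Measurable φ)
    (hb : ∃ C : ℝ, ∀ x, ‖φ x‖ ≤ C) (v : H) :
    inner ℂ v (E.integral φ v) = ∫ x, φ x ∂(E.measure v) := by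
  rw [integral, dif_pos ⟨hφ, hb⟩]
  exact (E.exists_integral hφ hb).choose_spec v

/-- `p` holds `E`-almost everywhere: it holds outside a set `s` with `E(s) = 0`. -/
def AE (E : PVM X H) (p : X → Prop) : Prop :=
  ∃ s, MeasurableSet s ∧ E.proj s = 0 ∧ ∀ x ∉ s, p x

/-- `∫ φ dE` depends only on the `E`-almost everywhere class of `φ`. -/
theorem integral_congr_ae (E : PVM X H) {φ ψ : X → ℂ} (hφ : Measurable φ)
    (hbφ : ∃ C : ℝ, ∀ x, ‖φ x‖ ≤ C) (hψ : Measurable ψ) (hbψ : ∃ C : ℝ, ∀ x, ‖ψ x‖ ≤ C)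
    (h : E.AE fun x => φ x = ψ x) : E.integral φ = E.integral ψ := by
  obtain ⟨s, hs, hs0, hst⟩ := h
  have hq : ∀ v, inner ℂ v (E.integral φ v) = inner ℂ v (E.integral ψ v) := by
    intro v
    rw [E.inner_integral hφ hbφ, E.inner_integral hψ hbψ]
    refine MeasureTheory.integral_congr_ae ?_
    have h0 : E.measure v s = 0 := by rw [E.measure_apply v hs, hs0]; simp
    filter_upwards [compl_mem_ae_iff.2 h0] with x hx
    exact hst x hx
  have : (E.integral φ : H →ₗ[ℂ] H) = E.integral ψ := by
    rw [← ext_inner_map]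
    intro v
    change inner ℂ (E.integral φ v) v = inner ℂ (E.integral ψ v) v
    rw [← inner_conj_symm (E.integral φ v) v, ← inner_conj_symm (E.integral ψ v) v, hq]
  ext v
  exact congrArg (fun A : H →ₗ[ℂ] H => A v) this

end PVM

end Integral

section Product

variable {X Y : Type*} [MeasurableSpace X] [MeasurableSpace Y]
  {K H : Type*} [NormedAddCommGroup K] [InnerProductSpace ℂ K] [CompleteSpace K]
  [NormedAddCommGroup H] [InnerProductSpace ℂ H] [CompleteSpace H]

theorem isSetSemiring_rect :
    IsSetSemiring (Set.image2 (fun s t => s ×ˢ t) {s : Set X | MeasurableSet s}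
      {t : Set Y | MeasurableSet t}) where
  empty_mem := ⟨∅, .empty, ∅, .empty, by simp⟩
  inter_mem := by
    rintro _ ⟨s, hs, t, ht, rfl⟩ _ ⟨s', hs', t', ht', rfl⟩
    exact ⟨s ∩ s', hs.inter hs', t ∩ t', ht.inter ht', Set.prod_inter_prod.symm⟩
  sdiff_eq_sUnion' := by
    classical
    rintro _ ⟨s, hs, t, ht, rfl⟩ _ ⟨s', hs', t', ht', rfl⟩
    refine ⟨{(s \ s') ×ˢ t, (s ∩ s') ×ˢ (t \ t')}, ?_, ?_, ?_⟩
    · intro u hu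
      simp only [Finset.coe_insert, Finset.coe_singleton, Set.mem_insert_iff,
        Set.mem_singleton_iff] at hu
      rcases hu with rfl | rfl
      · exact ⟨_, hs.diff hs', _, ht, rfl⟩
      · exact ⟨_, hs.inter hs', _, ht.diff ht', rfl⟩
    · have hd : Disjoint ((s \ s') ×ˢ t) ((s ∩ s') ×ˢ (t \ t')) :=
        Set.disjoint_left.2 fun x hx hx' => hx.1.2 hx'.1.2
      simp only [Finset.coe_insert, Finset.coe_singleton]
      exact Set.pairwise_pair.2 fun _ => ⟨hd, hd.symm⟩
    · ext ⟨x, y⟩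
      simp only [Finset.coe_insert, Finset.coe_singleton, Set.sUnion_insert, Set.sUnion_singleton,
        Set.mem_sdiff, Set.mem_prod, Set.mem_union, Set.mem_inter_iff]
      tauto

theorem isHilbertSchmidt_rankOne (x : H) (y : K) :
    IsHilbertSchmidt (InnerProductSpace.rankOne ℂ x y) := by
  rw [isHilbertSchmidt_iff]
  have : ∀ i, ‖InnerProductSpace.rankOne ℂ x y (stdBasis K i)‖ₑ ^ 2
      = ‖x‖ₑ ^ 2 * ‖inner ℂ (stdBasis K i) y‖ₑ ^ 2 := fun i => by
    rw [InnerProductSpace.rankOne_apply, enorm_smul, mul_pow, mul_comm, ← inner_conj_symm,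
      RCLike.enorm_conj]
  simp only [this]
  rw [ENNReal.tsum_mul_left, tsum_enorm_inner_sq]
  finiteness

/-- The rank-one operator `|x⟩⟨y|` as a Hilbert–Schmidt operator. -/
noncomputable def HS.ketBra (x : H) (y : K) : HS K H :=
  HS.mk (InnerProductSpace.rankOne ℂ x y) (isHilbertSchmidt_rankOne x y)

theorem HS.inner_ketBra (x : H) (y : K) (S : HS K H) :
    inner ℂ (HS.ketBra x y) S = inner ℂ x (S.op y) := by
  have h1 := ((stdBasis K).hasSum_repr y).mapL S.op
  have h2 := h1.mapL (innerSL ℂ x)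
  rw [← innerSL_apply_apply ℂ x (S.op y), ← h2.tsum_eq]
  change ∑' i, inner ℂ ((HS.ketBra x y).op (stdBasis K i)) (S.op (stdBasis K i)) = _
  refine tsum_congr fun i => ?_
  rw [HS.ketBra, HS.op_mk, InnerProductSpace.rankOne_apply, inner_smul_left, inner_conj_symm,
    map_smul, map_smul, HilbertBasis.repr_apply_apply, smul_eq_mul, innerSL_apply_apply]

theorem HS.norm_ketBra (x : H) (y : K) : ‖HS.ketBra x y‖ ^ 2 = ‖x‖ ^ 2 * ‖y‖ ^ 2 := by
  have h := HS.inner_ketBra x y (HS.ketBra x y)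
  rw [HS.ketBra, HS.op_mk, InnerProductSpace.rankOne_apply, inner_smul_right,
    inner_self_eq_norm_sq_to_K, inner_self_eq_norm_sq_to_K, inner_self_eq_norm_sq_to_K] at h
  have h' : ((‖HS.ketBra x y‖ ^ 2 : ℝ) : ℂ) = ((‖y‖ ^ 2 * ‖x‖ ^ 2 : ℝ) : ℂ) := by
    push_cast; exact h
  rw [Complex.ofReal_injective h', mul_comm]

variable (K H) in
theorem HS.dense_ketBra :
    Dense (Submodule.span ℂ {R : HS K H | ∃ x y, R = HS.ketBra x y} : Set (HS K H)) := by
  rw [Submodule.dense_iff_topologicalClosure_eq_top, Submodule.topologicalClosure_eq_top_iff,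
    Submodule.eq_bot_iff]
  intro S hS
  rw [Submodule.mem_orthogonal] at hS
  refine HS.op_injective (ContinuousLinearMap.ext fun y => ?_)
  rw [map_zero, zero_apply, ← inner_self_eq_zero (𝕜 := ℂ), ← HS.inner_ketBra]
  exact hS _ (Submodule.subset_span ⟨_, _, rfl⟩)

/-- The operator `T ↦ A T B` on Hilbert–Schmidt operators. -/
noncomputable def HS.sandwich (A : H →L[ℂ] H) (B : K →L[ℂ] K) : HS K H →L[ℂ] HS K H :=
  LinearMap.mkContinuous
    { toFun := fun T => HS.mk (A ∘L T.op ∘L B) ((T.isHilbertSchmidt.right B).left A)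
      map_add' := fun S T => HS.op_injective (by simp)
      map_smul' := fun c T => HS.op_injective (by simp) }
    (‖A‖ * ‖B‖) (by
      intro T
      have h : ‖HS.mk (A ∘L T.op ∘L B) ((T.isHilbertSchmidt.right B).left A)‖ₑ
          ≤ ‖A‖ₑ * ‖B‖ₑ * ‖T‖ₑ := by
        refine (ENNReal.pow_le_pow_left_iff two_ne_zero).1 ?_
        have h1 : ∑' i, ‖(T.op ∘L B) (stdBasis K i)‖ₑ ^ 2 ≤ ‖B‖ₑ ^ 2 * ‖T‖ₑ ^ 2 := by
          rw [HS.enorm_sq, tsum_adjoint _ (stdBasis H), tsum_adjoint _ (stdBasis H),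
            ← ENNReal.tsum_mul_left, ContinuousLinearMap.adjoint_comp]
          refine ENNReal.tsum_le_tsum fun j => ?_
          rw [← mul_pow, ← (ContinuousLinearMap.adjoint : _ ≃ₗᵢ⋆[ℂ] (K →L[ℂ] K)).enorm_map B]
          gcongr
          exact ContinuousLinearMap.le_opENorm _ _
        rw [HS.enorm_sq, mul_pow, mul_pow, mul_assoc]
        refine le_trans ?_ (mul_le_mul_right h1 _)
        rw [← ENNReal.tsum_mul_left]
        refine ENNReal.tsum_le_tsum fun j => ?_
        rw [← mul_pow]
        gcongr
        exact ContinuousLinearMap.le_opENorm _ _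
      rw [← ofReal_norm, ← ofReal_norm, ← ofReal_norm, ← ofReal_norm,
        ← ENNReal.ofReal_mul (norm_nonneg _),
        ← ENNReal.ofReal_mul (by positivity)] at h
      exact (ENNReal.ofReal_le_ofReal_iff (by positivity)).1 h)

@[simp] theorem HS.op_sandwich (A : H →L[ℂ] H) (B : K →L[ℂ] K) (T : HS K H) :
    (HS.sandwich A B T).op = A ∘L T.op ∘L B := rfl

theorem HS.adjoint_sandwich (A : H →L[ℂ] H) (B : K →L[ℂ] K) :
    (HS.sandwich A B).adjoint = HS.sandwich A.adjoint B.adjoint := by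
  refine ContinuousLinearMap.ext_on (HS.dense_ketBra K H) ?_
  rintro _ ⟨x, y, rfl⟩
  refine ext_inner_right ℂ fun S => ?_
  have h : HS.sandwich A.adjoint B.adjoint (HS.ketBra x y)
      = HS.ketBra (A.adjoint x) (B y) := by
    refine HS.op_injective (ContinuousLinearMap.ext fun z => ?_)
    simp [HS.ketBra, ContinuousLinearMap.adjoint_inner_right]
  rw [h, ContinuousLinearMap.adjoint_inner_left, HS.inner_ketBra, HS.inner_ketBra, HS.op_sandwich,
    ContinuousLinearMap.adjoint_inner_left]
  rfl

theorem HS.sandwich_mul (A A' : H →L[ℂ] H) (B B' : K →L[ℂ] K) :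
    HS.sandwich A B * HS.sandwich A' B' = HS.sandwich (A * A') (B' * B) := rfl

theorem HS.isStarProjection_sandwich {A : H →L[ℂ] H} {B : K →L[ℂ] K} (hA : IsStarProjection A)
    (hB : IsStarProjection B) : IsStarProjection (HS.sandwich A B) where
  isIdempotentElem := by
    rw [IsIdempotentElem, HS.sandwich_mul, hA.isIdempotentElem.eq, hB.isIdempotentElem.eq]
  isSelfAdjoint := by
    rw [IsSelfAdjoint, ContinuousLinearMap.star_eq_adjoint, HS.adjoint_sandwich,
      ← ContinuousLinearMap.star_eq_adjoint, ← ContinuousLinearMap.star_eq_adjoint,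
      hA.isSelfAdjoint.star_eq, hB.isSelfAdjoint.star_eq]

/-- There is a projection-valued measure `𝒢` on `𝔖₂(K, H)` with
`𝒢(Γ × Δ) T = E(Γ) T F(Δ)`. -/
theorem exists_prodPVM (E : PVM X H) (F : PVM Y K) :
    ∃ G : PVM (X × Y) (HS K H), ∀ s t, MeasurableSet s → MeasurableSet t →
      ∀ T, (G.proj (s ×ˢ t) T).op = E.proj s ∘L T.op ∘L F.proj t := by
  let P : Set (X × Y) → HS K H →L[ℂ] HS K H := fun Λ =>
    HS.sandwich (E.proj (Prod.fst '' Λ)) (F.proj (Prod.snd '' Λ))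
  have hr : ∀ s t, P (s ×ˢ t) = HS.sandwich (E.proj s) (F.proj t) := by
    intro s t
    rcases s.eq_empty_or_nonempty with rfl | hs
    · ext T; refine HS.op_injective ?_; simp [P, E.proj_empty]
    rcases t.eq_empty_or_nonempty with rfl | ht
    · ext T; refine HS.op_injective ?_; simp [P, F.proj_empty]
    simp only [P, Set.fst_image_prod s ht, Set.snd_image_prod hs t]
  obtain ⟨G, hG⟩ := exists_extension (P := P) isSetSemiring_rect generateFrom_prod.symm
    (by rintro _ ⟨s, hs, t, ht, rfl⟩
        simp only [hr]
        exact HS.isStarProjection_sandwich (E.isStarProjection s hs) (F.isStarProjection t ht))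
    (by ext T; refine HS.op_injective ?_; simp [P, E.proj_empty])
    ⟨Set.univ, .univ, Set.univ, .univ, Set.univ_prod_univ⟩
    (by rw [← Set.univ_prod_univ, hr, E.proj_univ, F.proj_univ]; rfl)
    (by rintro _ ⟨s, hs, t, ht, rfl⟩ _ ⟨s', hs', t', ht', rfl⟩
        simp only [hr, Set.prod_inter_prod]
        rw [HS.sandwich_mul, E.proj_inter hs hs', Set.inter_comm t, F.proj_inter ht' ht])
    (HS.dense_ketBra K H)
    (by rintro _ ⟨x, y, rfl⟩
        refine ⟨(E.measure x).prod (F.measure y), inferInstance, ?_⟩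
        rintro _ ⟨s, hs, t, ht, rfl⟩
        simp only [hr]
        have h : HS.sandwich (E.proj s) (F.proj t) (HS.ketBra x y)
            = HS.ketBra (E.proj s x) (F.proj t y) := by
          refine HS.op_injective (ContinuousLinearMap.ext fun z => ?_)
          simp [HS.ketBra, inner_proj_left (F.isStarProjection t ht)]
        rw [h, HS.norm_ketBra, measureReal_prod_prod, E.real_measure_apply x hs,
          F.real_measure_apply y ht])
  refine ⟨G, fun s t hs ht T => ?_⟩
  rw [hG _ ⟨s, hs, t, ht, rfl⟩, hr]
  rfl

/-- The projection-valued measure `𝒢` on `X × Y` with values in the bounded operators on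
`𝔖₂(K, H)` such that `𝒢(Γ × Δ) T = E(Γ) T F(Δ)` (`prodPVM_rect`, `prodPVM_unique`). -/
noncomputable def prodPVM (E : PVM X H) (F : PVM Y K) : PVM (X × Y) (HS K H) :=
  (exists_prodPVM E F).choose

theorem prodPVM_rect (E : PVM X H) (F : PVM Y K) {s : Set X} {t : Set Y} (hs : MeasurableSet s)
    (ht : MeasurableSet t) (T : HS K H) :
    ((prodPVM E F).proj (s ×ˢ t) T).op = E.proj s ∘L T.op ∘L F.proj t :=
  (exists_prodPVM E F).choose_spec s t hs ht T

theorem prodPVM_unique (E : PVM X H) (F : PVM Y K) (G : PVM (X × Y) (HS K H))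
    (hG : ∀ s t, MeasurableSet s → MeasurableSet t →
      ∀ T, (G.proj (s ×ˢ t) T).op = E.proj s ∘L T.op ∘L F.proj t) : G = prodPVM E F := by
  have hμ : ∀ T, G.measure T = (prodPVM E F).measure T := by
    intro T
    refine ext_of_generate_finite _ generateFrom_prod.symm isPiSystem_prod ?_ ?_
    · rintro _ ⟨s, hs, t, ht, rfl⟩
      rw [G.measure_apply _ (hs.prod ht), (prodPVM E F).measure_apply _ (hs.prod ht),
        HS.op_injective ((hG s t hs ht T).trans (prodPVM_rect E F hs ht T).symm)]
    · rw [G.measure_apply _ .univ, (prodPVM E F).measure_apply _ .univ, G.proj_univ,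
        (prodPVM E F).proj_univ]
  refine PVM.ext_proj fun s hs => proj_ext (G.isStarProjection s hs)
    ((prodPVM E F).isStarProjection s hs) fun T => ?_
  rw [← G.real_measure_apply T hs, ← (prodPVM E F).real_measure_apply T hs, hμ]

end Product

section TraceClass

variable {K H : Type*} [NormedAddCommGroup K] [InnerProductSpace ℂ K] [CompleteSpace K]
  [NormedAddCommGroup H] [InnerProductSpace ℂ H] [CompleteSpace H]

/-- The absolute value `|T| = (T* T)^{1/2}` of a bounded operator `T : K → H`. -/
noncomputable def absOp (T : K →L[ℂ] H) : K →L[ℂ] K := CFC.sqrt (T.adjoint ∘L T)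

/-- The trace norm `‖T‖₁ = Tr |T| = ∑ ⟪eᵢ, |T| eᵢ⟫ ∈ [0, ∞]`, for an orthonormal basis `(eᵢ)`. -/
noncomputable def traceNorm (T : K →L[ℂ] H) : ℝ≥0∞ :=
  ∑' i, ENNReal.ofReal (inner ℂ (stdBasis K i) (absOp T (stdBasis K i))).re

/-- `T` is trace class, that is `T ∈ 𝔖₁(K, H)`. -/
def IsTraceClass (T : K →L[ℂ] H) : Prop := traceNorm T < ⊤

theorem enorm_sqrt_sq {A : K →L[ℂ] K} (hA : 0 ≤ A) (x : K) :
    ‖CFC.sqrt A x‖ₑ ^ 2 = ENNReal.ofReal (inner ℂ x (A x)).re := by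
  have h1 : CFC.sqrt A * CFC.sqrt A = A := CFC.sqrt_mul_sqrt_self A hA
  have h2 : (CFC.sqrt A).adjoint = CFC.sqrt A := by
    rw [← ContinuousLinearMap.star_eq_adjoint]
    exact (IsSelfAdjoint.of_nonneg (CFC.sqrt_nonneg A)).star_eq
  have h3 : inner ℂ x (A x) = inner ℂ (CFC.sqrt A x) (CFC.sqrt A x) := by
    rw [← ContinuousLinearMap.adjoint_inner_right, h2]
    exact congrArg (fun B : K →L[ℂ] K => inner ℂ x (B x)) h1.symm
  rw [h3, inner_self_eq_norm_sq_to_K]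
  rw [← ofReal_norm, ← ENNReal.ofReal_pow (norm_nonneg _)]
  norm_cast

theorem adjoint_comp_self_nonneg (T : K →L[ℂ] H) : 0 ≤ T.adjoint ∘L T := by
  rw [ContinuousLinearMap.nonneg_iff_isPositive]
  exact ContinuousLinearMap.isPositive_adjoint_comp_self T

/-- The trace norm does not depend on the orthonormal basis. -/
theorem traceNorm_eq {ι : Type*} (b : HilbertBasis ι ℂ K) (T : K →L[ℂ] H) :
    traceNorm T = ∑' i, ENNReal.ofReal (inner ℂ (b i) (absOp T (b i))).re := by
  have h : (0 : K →L[ℂ] K) ≤ absOp T := CFC.sqrt_nonneg _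
  simp only [traceNorm, ← enorm_sqrt_sq h]
  exact (tsum_hilbertBasis_eq b _).symm

/-- Trace-class operators are Hilbert–Schmidt. -/
theorem IsTraceClass.isHilbertSchmidt {T : K →L[ℂ] H} (hT : IsTraceClass T) :
    IsHilbertSchmidt T := by
  have h : (0 : K →L[ℂ] K) ≤ absOp T := CFC.sqrt_nonneg _
  have h1 : ∀ x, ‖T x‖ₑ ^ 2 = ‖absOp T x‖ₑ ^ 2 := by
    intro x
    rw [absOp, enorm_sqrt_sq (adjoint_comp_self_nonneg T), ContinuousLinearMap.comp_apply,
      ContinuousLinearMap.adjoint_inner_right, inner_self_eq_norm_sq_to_K]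
    rw [← ofReal_norm, ← ENNReal.ofReal_pow (norm_nonneg _)]
    norm_cast
  have h2 : CFC.sqrt (absOp T) * CFC.sqrt (absOp T) = absOp T := CFC.sqrt_mul_sqrt_self _ h
  have h3 : ∀ x, ‖absOp T x‖ₑ ^ 2
      ≤ ‖CFC.sqrt (absOp T)‖ₑ ^ 2 * ENNReal.ofReal (inner ℂ x (absOp T x)).re := by
    intro x
    rw [← enorm_sqrt_sq h, ← mul_pow]
    have : absOp T x = CFC.sqrt (absOp T) (CFC.sqrt (absOp T) x) :=
      congrArg (fun B : K →L[ℂ] K => B x) h2.symm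
    rw [this]
    gcongr
    exact ContinuousLinearMap.le_opENorm _ _
  rw [isHilbertSchmidt_iff]
  simp only [h1]
  refine ((ENNReal.tsum_le_tsum fun i => h3 _).trans_lt ?_).ne
  rw [ENNReal.tsum_mul_left]
  exact ENNReal.mul_lt_top (by finiteness) hT

/-- The operator norm `𝔖₁(K, H) → 𝔖₁(K, H)`, with values in `[0, ∞]`, of an operator given on
`𝔖₂(K, H)`: the supremum of `‖Φ T‖₁` over all `T` with `‖T‖₁ ≤ 1`. -/
noncomputable def traceOpNorm (Φ : HS K H →L[ℂ] HS K H) : ℝ≥0∞ :=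
  ⨆ (T : HS K H) (_ : traceNorm T.op ≤ 1), traceNorm (Φ T).op

end TraceClass

section FunctionSpace

variable {X : Type u₁} {Y : Type u₂} [MeasurableSpace X] [MeasurableSpace Y]
  {K : Type u₃} {H : Type u₄} [NormedAddCommGroup K] [InnerProductSpace ℂ K] [CompleteSpace K]
  [NormedAddCommGroup H] [InnerProductSpace ℂ H] [CompleteSpace H]

/-- A decomposition `φ(x, y) = ∫ α(x, z) β(y, z) dν(z)` for `𝒢`-a.e. `(x, y)`, where `ν` is a
finite positive measure and `α`, `β` are bounded measurable functions. -/
structure Decomposition (E : PVM X H) (F : PVM Y K) (φ : X × Y → ℂ) where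
  Z : Type w
  [measurableSpace : MeasurableSpace Z]
  ν : Measure Z
  isFiniteMeasure : IsFiniteMeasure ν
  α : X × Z → ℂ
  β : Y × Z → ℂ
  measurable_α : Measurable α
  measurable_β : Measurable β
  bounded_α : ∃ C : ℝ, ∀ p, ‖α p‖ ≤ C
  bounded_β : ∃ C : ℝ, ∀ p, ‖β p‖ ≤ C
  ae_eq : (prodPVM E F).AE fun p => φ p = ∫ z, α (p.1, z) * β (p.2, z) ∂ν

attribute [instance] Decomposition.measurableSpace

/-- `φ` represents an element of `𝔐`: it is a bounded measurable function on `X × Y` which has a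
decomposition. -/
def MemM (E : PVM X H) (F : PVM Y K) (φ : X × Y → ℂ) : Prop :=
  Measurable φ ∧ (∃ C : ℝ, ∀ p, ‖φ p‖ ≤ C) ∧ Nonempty (Decomposition.{w} E F φ)

/-- The norm of the class of `φ` in `𝔐`: the infimum over all decompositions of
`sup_{v, w} ∫ ‖α(·, z)‖_{L^∞(E_{v,v})} ‖β(·, z)‖_{L^∞(F_{w,w})} dν(z)`. -/
noncomputable def normM (E : PVM X H) (F : PVM Y K) (φ : X × Y → ℂ) : ℝ≥0∞ :=
  ⨅ d : Decomposition.{w} E F φ, ⨆ (v : H) (u : K),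
    ∫⁻ z, eLpNormEssSup (fun x => d.α (x, z)) (E.measure v)
      * eLpNormEssSup (fun y => d.β (y, z)) (F.measure u) ∂d.ν

/-- The norm of `𝔐` depends only on the `𝒢`-almost everywhere class of `φ`. -/
theorem normM_congr (E : PVM X H) (F : PVM Y K) {φ ψ : X × Y → ℂ}
    (h : (prodPVM E F).AE fun p => φ p = ψ p) : normM.{w} E F φ = normM.{w} E F ψ := by
  have key : ∀ φ ψ : X × Y → ℂ, ((prodPVM E F).AE fun p => φ p = ψ p) →
      normM.{w} E F φ ≤ normM.{w} E F ψ := by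
    rintro φ ψ ⟨s, hs, hs0, hst⟩
    refine le_iInf fun d => ?_
    have hae : (prodPVM E F).AE fun p => φ p = ∫ z, d.α (p.1, z) * d.β (p.2, z) ∂d.ν := by
      obtain ⟨t, ht, ht0, htt⟩ := d.ae_eq
      refine ⟨s ∪ t, hs.union ht, ?_, fun p hp => ?_⟩
      · rw [← Set.sdiff_union_self, (prodPVM E F).proj_union (hs.diff ht) ht
          Set.disjoint_sdiff_left, ht0, Set.sdiff_eq,
          (prodPVM E F).proj_inter hs ht.compl, hs0]
        simp
      · rw [Set.mem_union, not_or] at hp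
        exact (hst p hp.1).trans (htt p hp.2)
    exact iInf_le_of_le ⟨d.Z, d.ν, d.isFiniteMeasure, d.α, d.β, d.measurable_α, d.measurable_β,
      d.bounded_α, d.bounded_β, hae⟩ le_rfl
  refine le_antisymm (key φ ψ h) (key ψ φ ?_)
  obtain ⟨s, hs, hs0, hst⟩ := h
  exact ⟨s, hs, hs0, fun p hp => (hst p hp).symm⟩

end FunctionSpace

end DOI

namespace DOI

/-! ### Spectral integrals: norm estimates for `∫ φ dE`. -/

section SpectralIntegral

variable {H : Type*} [NormedAddCommGroup H] [InnerProductSpace ℂ H]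

/-! The estimate reduces to rank-one operators on one side and to duality on the other. A
trace-class operator is a sum of rank-one operators `|aᵢ⟩⟨bᵢ|` with `∑ ‖aᵢ‖ ‖bᵢ‖ ≤ ‖T‖₁`
(`exists_hasSum_ketBra`). The trace norm of `S` is at most the supremum of `|⟪R, S⟫|` over
Hilbert–Schmidt `R` of operator norm at most 1 (`traceNorm_le_of_inner_le`). Both facts come from
the polar decomposition. It therefore suffices to bound `⟪R, (∫ φ d𝒢) |a⟩⟨b|⟫` by a constant times
`‖a‖ ‖b‖`.

A decomposition of `φ` and Fubini's theorem write this pairing as an integral over `z` of the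
pairings for `α(·, z) ⊗ β(·, z)` (`inner_integral_eq`). For such a tensor the double operator
integral is `T ↦ A T B`, with `A = ∫ α(·, z) dE` and `B = ∫ β(·, z) dF` (`integral_prodPVM_mul`). It
sends `|a⟩⟨b|` to `|A a⟩⟨B* b|`, so the pairing is at most `‖A a‖ ‖B* b‖`. Now `‖A a‖² ≤ ∫ |α(·,
z)|² dE_{a,a} ≤ ‖α(·, z)‖² ‖a‖²`, with the essential supremum taken for `E_{a,a}` alone; similarly
for `B* b` and `F_{b,b}`.

The vectors `a`, `b` stay fixed while `z` varies. This is why the supremum over vectors may stand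
outside the integral over `Z` in the norm of `𝔐`.

Spectral integrals are characterised only by their quadratic forms, so identities between them are
proved on the diagonal and transferred by polarization. -/

theorem inner_polarization (A : H →L[ℂ] H) (u v : H) :
    inner ℂ u (A v) = (inner ℂ (u + v) (A (u + v)) - inner ℂ (u - v) (A (u - v))
      - Complex.I * inner ℂ (u + Complex.I • v) (A (u + Complex.I • v))
      + Complex.I * inner ℂ (u - Complex.I • v) (A (u - Complex.I • v))) / 4 := by
  simp only [map_add, map_sub, map_smul, inner_add_left, inner_add_right, inner_sub_left,
    inner_sub_right, inner_smul_left, inner_smul_right, Complex.conj_I]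
  ring_nf
  simp only [Complex.I_sq]
  ring

theorem ext_of_inner_self {A B : H →L[ℂ] H} (h : ∀ v, inner ℂ v (A v) = inner ℂ v (B v)) :
    A = B := by
  ext v
  refine ext_inner_left ℂ fun u => ?_
  rw [inner_polarization A, inner_polarization B]
  simp only [h]

namespace PVM

variable [CompleteSpace H] {X : Type*} [MeasurableSpace X]

/-- Needed because the right-hand factor of a sandwich acts on the bra vector through its adjoint.
-/
theorem adjoint_integral (E : PVM X H) {φ : X → ℂ} (hφ : Measurable φ)
    (hb : ∃ C : ℝ, ∀ x, ‖φ x‖ ≤ C) :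
    (E.integral φ).adjoint = E.integral fun x => starRingEnd ℂ (φ x) := by
  refine ext_of_inner_self fun v => ?_
  have hm : Measurable fun x => starRingEnd ℂ (φ x) :=
    Complex.continuous_conj.measurable.comp hφ
  rw [E.inner_integral hm (by simpa using hb),
    ContinuousLinearMap.adjoint_inner_right, ← inner_conj_symm, E.inner_integral hφ hb,
    integral_conj]

theorem integral_simpleFunc (E : PVM X H) (f : SimpleFunc X ℂ) :
    E.integral f = ∑ c ∈ f.range, c • E.proj (f ⁻¹' {c}) := by
  refine ext_of_inner_self fun v => ?_
  rw [E.inner_integral f.measurable f.exists_forall_norm_le,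
    ← SimpleFunc.integral_eq_integral _ (SimpleFunc.integrable_of_isFiniteMeasure _),
    SimpleFunc.integral_eq_sum_filter, Finset.sum_filter]
  simp only [sum_apply, smul_apply, inner_sum, inner_smul_right]
  refine Finset.sum_congr rfl fun c _ => ?_
  rw [inner_proj (E.isStarProjection _ (f.measurableSet_fiber c)),
    E.real_measure_apply v (f.measurableSet_fiber c)]
  -- The integral of a simple function is a sum over its nonzero values only; the value 0
  -- contributes nothing on either side.
  by_cases hc : c = 0
  · simp [hc]
  · simp [hc, mul_comm]

/-- Pythagoras: distinct fibres are disjoint, so their spectral projections have orthogonal ranges.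
-/
theorem norm_integral_simpleFunc (E : PVM X H) (f : SimpleFunc X ℂ) (v : H) :
    ‖E.integral f v‖ ^ 2 = ∫ x, ‖f x‖ ^ 2 ∂(E.measure v) := by
  have hP := fun c => E.isStarProjection _ (f.measurableSet_fiber c)
  have h1 : ∫ x, ‖f x‖ ^ 2 ∂(E.measure v)
      = ∑ c ∈ f.range, (E.measure v).real (f ⁻¹' {c}) * ‖c‖ ^ 2 := by
    have h := SimpleFunc.map_integral (μ := E.measure v) f (fun c => ‖c‖ ^ 2)
      (SimpleFunc.integrable_of_isFiniteMeasure f) (by simp)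
    rw [SimpleFunc.integral_eq_integral _ (SimpleFunc.integrable_of_isFiniteMeasure _)] at h
    simpa using h
  have ho : ∀ c d, c ≠ d → E.proj (f ⁻¹' {c}) * E.proj (f ⁻¹' {d}) = 0 := fun c d hcd =>
    E.proj_mul_of_disjoint (f.measurableSet_fiber d) (f.measurableSet_fiber c)
      (Set.disjoint_left.2 fun x hx hx' => hcd (hx'.symm.trans hx))
  have h2 : ∀ c ∈ f.range, ∀ d ∈ f.range, c ≠ d →
      inner ℂ (c • E.proj (f ⁻¹' {c}) v) (d • E.proj (f ⁻¹' {d}) v) = 0 := by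
    intro c _ d _ hcd
    have : E.proj (f ⁻¹' {c}) (E.proj (f ⁻¹' {d}) v) = 0 :=
      congrArg (fun A : H →L[ℂ] H => A v) (ho c d hcd)
    rw [inner_smul_left, inner_smul_right, inner_proj_left (hP c), this]
    simp
  have h3 : inner ℂ (E.integral f v) (E.integral f v)
      = ∑ c ∈ f.range, ((‖c • E.proj (f ⁻¹' {c}) v‖ ^ 2 : ℝ) : ℂ) := by
    rw [integral_simpleFunc, sum_apply, sum_inner]
    refine Finset.sum_congr rfl fun c hc => ?_
    rw [inner_sum, Finset.sum_eq_single_of_mem c hc]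
    · rw [smul_apply, inner_self_eq_norm_sq_to_K]; norm_cast
    · intro d hd hdc
      exact h2 c hc d hd hdc.symm
  rw [inner_self_eq_norm_sq_to_K, ← Complex.ofReal_sum] at h3
  have h4 : ‖E.integral f v‖ ^ 2 = ∑ c ∈ f.range, ‖c • E.proj (f ⁻¹' {c}) v‖ ^ 2 := by
    refine Complex.ofReal_injective (Eq.trans ?_ h3)
    exact Complex.ofReal_pow _ _
  rw [h1, h4]
  refine Finset.sum_congr rfl fun c _ => ?_
  rw [norm_smul, mul_pow, E.real_measure_apply v (f.measurableSet_fiber c), mul_comm]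

/-- Simple approximants converge to `∫ φ dE` in the weak operator sense, and the norm is weakly
lower semicontinuous. The inequality this yields is all that is used below. -/
theorem norm_integral_sq_le (E : PVM X H) {φ : X → ℂ} (hφ : Measurable φ)
    (hb : ∃ C : ℝ, ∀ x, ‖φ x‖ ≤ C) (v : H) :
    ‖E.integral φ v‖ ^ 2 ≤ ∫ x, ‖φ x‖ ^ 2 ∂(E.measure v) := by
  have hb' := hb
  obtain ⟨C, hC⟩ := hb'
  let f : ℕ → SimpleFunc X ℂ := fun n => SimpleFunc.approxOn φ hφ Set.univ 0 (Set.mem_univ 0) n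
  -- The approximants start at 0 and are bounded by `‖φ x‖ + ‖φ x‖`, hence the constant `C + C`.
  have hfC : ∀ n x, ‖f n x‖ ≤ C + C := fun n x =>
    (SimpleFunc.norm_approxOn_zero_le hφ (Set.mem_univ 0) x n).trans (add_le_add (hC x) (hC x))
  have hf : ∀ x, Tendsto (fun n => f n x) atTop (𝓝 (φ x)) := fun x =>
    SimpleFunc.tendsto_approxOn hφ (Set.mem_univ 0) (by simp)
  have hq : ∀ u, Tendsto (fun n => inner ℂ u (E.integral (f n) u)) atTop
      (𝓝 (inner ℂ u (E.integral φ u))) := by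
    intro u
    rw [E.inner_integral hφ hb]
    simp only [fun n => E.inner_integral (f n).measurable (f n).exists_forall_norm_le u]
    exact tendsto_integral_of_dominated_convergence (fun _ => C + C)
      (fun n => (f n).aestronglyMeasurable) (integrable_const _)
      (fun n => Eventually.of_forall (hfC n)) (Eventually.of_forall hf)
  -- Polarization turns convergence of the quadratic forms into convergence of this off-diagonal
  -- entry.
  have hw : Tendsto (fun n => inner ℂ (E.integral φ v) (E.integral (f n) v)) atTop
      (𝓝 (inner ℂ (E.integral φ v) (E.integral φ v))) := by
    simp only [inner_polarization _ (E.integral φ v) v]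
    exact ((((hq _).sub (hq _)).sub ((hq _).const_mul _)).add ((hq _).const_mul _)).div_const 4
  have hn : Tendsto (fun n => ‖E.integral (f n) v‖ ^ 2) atTop
      (𝓝 (∫ x, ‖φ x‖ ^ 2 ∂(E.measure v))) := by
    simp only [norm_integral_simpleFunc]
    refine tendsto_integral_of_dominated_convergence (fun _ => (C + C) ^ 2)
      (fun n => ((f n).measurable.norm.pow_const 2).aestronglyMeasurable) (integrable_const _)
      (fun n => Eventually.of_forall fun x => ?_)
      (Eventually.of_forall fun x => (hf x).norm.pow 2)
    rw [norm_pow, norm_norm]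
    gcongr
    exact hfC n x
  set w := E.integral φ v
  -- Cauchy–Schwarz `|⟪w, Aₙ v⟫|² ≤ ‖w‖² ‖Aₙ v‖²` passes to the limit, where the left side is
  -- `‖w‖⁴`; for `w ≠ 0` a factor `‖w‖²` is then cancelled.
  have hle : ‖w‖ ^ 4 ≤ ‖w‖ ^ 2 * ∫ x, ‖φ x‖ ^ 2 ∂(E.measure v) := by
    refine le_of_tendsto_of_tendsto' (f := fun n => ‖inner ℂ w (E.integral (f n) v)‖ ^ 2)
      ?_ (hn.const_mul (‖w‖ ^ 2)) fun n => ?_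
    · have := hw.norm.pow 2
      rw [inner_self_eq_norm_sq_to_K] at this
      simpa [← pow_mul] using this
    · rw [← mul_pow]
      gcongr
      exact norm_inner_le_norm _ _
  by_cases h0 : ‖w‖ = 0
  · rw [h0, zero_pow two_ne_zero]
    exact integral_nonneg fun _ => by positivity
  · have : 0 < ‖w‖ ^ 2 := by positivity
    nlinarith

/-- The measure `E_{v,v}` has total mass `‖v‖²`, and only the values of `φ` that this measure sees
enter the second moment. -/
theorem enorm_integral_le (E : PVM X H) {φ : X → ℂ} (hφ : Measurable φ)
    (hb : ∃ C : ℝ, ∀ x, ‖φ x‖ ≤ C) (v : H) :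
    ‖E.integral φ v‖ₑ ≤ eLpNormEssSup φ (E.measure v) * ‖v‖ₑ := by
  have hfin : eLpNormEssSup φ (E.measure v) ≠ ⊤ := by
    obtain ⟨C, hC⟩ := hb
    exact (eLpNormEssSup_lt_top_of_ae_bound (Eventually.of_forall hC)).ne
  set M := (eLpNormEssSup φ (E.measure v)).toReal with hM
  have hae : ∀ᵐ x ∂(E.measure v), ‖φ x‖ ≤ M := by
    filter_upwards [enorm_ae_le_eLpNormEssSup φ (E.measure v)] with x hx
    rw [← toReal_enorm]
    exact ENNReal.toReal_mono hfin hx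
  have h1 : ∫ x, ‖φ x‖ ^ 2 ∂(E.measure v) ≤ (M * ‖v‖) ^ 2 := by
    have : ∫ x, ‖φ x‖ ^ 2 ∂(E.measure v) ≤ ∫ _, M ^ 2 ∂(E.measure v) := by
      refine integral_mono_of_nonneg (Eventually.of_forall fun _ => by positivity)
        (integrable_const _) ?_
      filter_upwards [hae] with x hx
      exact pow_le_pow_left₀ (norm_nonneg _) hx 2
    rw [integral_const, E.measure_real_univ, smul_eq_mul] at this
    rw [mul_pow]; linarith
  have h2 : ‖E.integral φ v‖ ≤ M * ‖v‖ :=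
    (pow_le_pow_iff_left₀ (norm_nonneg _) (by positivity) two_ne_zero).1
      ((E.norm_integral_sq_le hφ hb v).trans h1)
  rw [← ENNReal.ofReal_toReal hfin, ← hM, ← ofReal_norm, ← ofReal_norm,
    ← ENNReal.ofReal_mul ENNReal.toReal_nonneg]
  exact ENNReal.ofReal_le_ofReal h2

end PVM

end SpectralIntegral

/-! ### Polar decomposition, rank-one expansions and duality for the trace norm. -/

section Polar

variable {K H : Type*} [NormedAddCommGroup K] [InnerProductSpace ℂ K] [CompleteSpace K]
  [NormedAddCommGroup H] [InnerProductSpace ℂ H] [CompleteSpace H]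

theorem absOp_nonneg (T : K →L[ℂ] H) : 0 ≤ absOp T := CFC.sqrt_nonneg _

/-- Both squared norms equal `⟪x, T* T x⟫`. This makes `|T| x ↦ T x` a well-defined isometry. -/
theorem norm_absOp_apply (T : K →L[ℂ] H) (x : K) : ‖absOp T x‖ = ‖T x‖ := by
  have h1 : ‖absOp T x‖ₑ ^ 2 = ‖T x‖ₑ ^ 2 := by
    rw [absOp, enorm_sqrt_sq (adjoint_comp_self_nonneg T), ContinuousLinearMap.comp_apply,
      ContinuousLinearMap.adjoint_inner_right, inner_self_eq_norm_sq_to_K, ← ofReal_norm,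
      ← ENNReal.ofReal_pow (norm_nonneg _)]
    norm_cast
  have h2 := le_antisymm ((ENNReal.pow_le_pow_left_iff two_ne_zero).1 h1.le)
    ((ENNReal.pow_le_pow_left_iff two_ne_zero).1 h1.ge)
  rw [← toReal_enorm, h2, toReal_enorm]

/-- Polar decomposition: `T = U |T|` and `U* T = |T|` for a contraction `U`. -/
theorem exists_polar (T : K →L[ℂ] H) :
    ∃ U : K →L[ℂ] H, ‖U‖ ≤ 1 ∧ U ∘L absOp T = T ∧ U.adjoint ∘L T = absOp T := by
  set P := absOp T
  let V : Submodule ℂ K := P.range.topologicalClosure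
  have hmem : ∀ x, P x ∈ V := fun x => P.range.le_topologicalClosure ⟨x, rfl⟩
  let e : K →ₗ[ℂ] V := LinearMap.codRestrict V (P : K →ₗ[ℂ] K) hmem
  have he : DenseRange e := by
    intro y
    have hy : (y : K) ∈ closure (P.range : Set K) := by
      rw [← Submodule.topologicalClosure_coe]; exact y.2
    rw [Metric.mem_closure_iff] at hy ⊢
    intro ε hε
    obtain ⟨_, ⟨x, rfl⟩, hx⟩ := hy ε hε
    exact ⟨e x, ⟨x, rfl⟩, hx⟩
  have hn : ∀ x, ‖(T : K →ₗ[ℂ] H) x‖ ≤ 1 * ‖e x‖ := fun x => by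
    rw [one_mul]; exact (norm_absOp_apply T x).ge
  -- `W` extends `|T| x ↦ T x` to the closed range of `|T|`; composing it with the orthogonal
  -- projection makes `U` vanish on the complement.
  let W : V →L[ℂ] H := (T : K →ₗ[ℂ] H).extendOfNorm e
  have : V.HasOrthogonalProjection := by
    have : CompleteSpace V := P.range.isClosed_topologicalClosure.completeSpace_coe
    infer_instance
  let U : K →L[ℂ] H := W ∘L V.orthogonalProjectionOnto
  have hU : ∀ x, U (P x) = T x := by
    intro x
    have h1 : V.orthogonalProjectionOnto (P x) = e x :=
      Submodule.orthogonalProjectionOnto_mem_subspace_eq_self (K := V) (e x)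
    have h2 : W (e x) = T x := LinearMap.extendOfNorm_eq he ⟨1, hn⟩ x
    rw [ContinuousLinearMap.comp_apply, h1, h2]
  have hU1 : ‖U‖ ≤ 1 := by
    refine (ContinuousLinearMap.opNorm_comp_le _ _).trans ?_
    exact mul_le_one₀ (LinearMap.opNorm_extendOfNorm_le he zero_le_one hn) (norm_nonneg _)
      V.orthogonalProjectionOnto_norm_le
  refine ⟨U, hU1, ContinuousLinearMap.ext hU, ContinuousLinearMap.ext fun x => ?_⟩
  change U.adjoint (T x) = P x
  -- The second identity is the equality case of a contraction estimate: `‖U* T x‖ ≤ ‖|T| x‖` and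
  -- `Re ⟪U* T x, |T| x⟫ = ‖|T| x‖²` force `‖U* T x - |T| x‖² ≤ 0`.
  have h1 : ‖U.adjoint (T x)‖ ≤ ‖P x‖ := by
    refine (U.adjoint.le_opNorm _).trans ?_
    rw [norm_absOp_apply T x, LinearIsometryEquiv.norm_map]
    exact mul_le_of_le_one_left (norm_nonneg _) hU1
  have h2 : RCLike.re (inner ℂ (U.adjoint (T x)) (P x)) = ‖P x‖ ^ 2 := by
    rw [ContinuousLinearMap.adjoint_inner_left, hU, inner_self_eq_norm_sq, norm_absOp_apply T x]
  have h3 := norm_sub_sq (𝕜 := ℂ) (U.adjoint (T x)) (P x)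
  rw [h2] at h3
  have h4 := pow_le_pow_left₀ (norm_nonneg _) h1 2
  have h5 : ‖U.adjoint (T x) - P x‖ ^ 2 = 0 := le_antisymm (by linarith) (sq_nonneg _)
  exact sub_eq_zero.1 (norm_eq_zero.1 (pow_eq_zero_iff two_ne_zero |>.1 h5))

/-- A trace-class operator is a sum of rank-one operators whose norms add up to at most the trace
norm. -/
theorem exists_hasSum_ketBra (T : HS K H) (hT : IsTraceClass T.op) :
    ∃ (a : basisIndex K → H) (b : basisIndex K → K), HasSum (fun i => HS.ketBra (a i) (b i)) T ∧
      ∑' i, ‖a i‖ₑ * ‖b i‖ₑ ≤ traceNorm T.op := by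
  obtain ⟨U, hU1, hU, -⟩ := exists_polar T.op
  -- With `Q = |T|^{1/2}`, inserting `∑ |eᵢ⟩⟨eᵢ|` between the two factors `Q` of `T = U Q Q` gives
  -- `T = ∑ |U Q eᵢ⟩⟨Q eᵢ|`. The norms are controlled by `‖U Q eᵢ‖ ‖Q eᵢ‖ ≤ ‖Q eᵢ‖² = ⟪eᵢ, |T| eᵢ⟫`.
  set Q := CFC.sqrt (absOp T.op) with hQ
  have hQQ : ∀ x, Q (Q x) = absOp T.op x := fun x =>
    congrArg (fun A : K →L[ℂ] K => A x) (CFC.sqrt_mul_sqrt_self _ (absOp_nonneg T.op))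
  have hQa : Q.adjoint = Q := by
    rw [← ContinuousLinearMap.star_eq_adjoint]
    exact (IsSelfAdjoint.of_nonneg (CFC.sqrt_nonneg _)).star_eq
  let b : basisIndex K → K := fun i => Q (stdBasis K i)
  have hsum : ∑' i, ‖U (b i)‖ₑ * ‖b i‖ₑ ≤ traceNorm T.op := by
    refine ENNReal.tsum_le_tsum fun i => ?_
    rw [← enorm_sqrt_sq (absOp_nonneg T.op), sq]
    gcongr
    refine (U.le_opENorm _).trans (mul_le_of_le_one_left zero_le ?_)
    rw [← ofReal_norm]
    exact ENNReal.ofReal_le_one.2 hU1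
  refine ⟨fun i => U (b i), b, ?_, hsum⟩
  -- The series converges absolutely, since the Hilbert–Schmidt norm of `|a⟩⟨b|` is `‖a‖ ‖b‖`. Its
  -- sum is then identified with `T` through matrix entries.
  have hs : Summable fun i => HS.ketBra (U (b i)) (b i) := by
    refine Summable.of_norm ?_
    have h1 : ∀ i, ‖HS.ketBra (U (b i)) (b i)‖ = (‖U (b i)‖ₑ * ‖b i‖ₑ).toReal := fun i => by
      rw [ENNReal.toReal_mul, toReal_enorm, toReal_enorm]
      refine (pow_left_inj₀ (norm_nonneg _) (by positivity) two_ne_zero).1 ?_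
      rw [HS.norm_ketBra, mul_pow]
    simp only [h1]
    exact ENNReal.summable_toReal (hsum.trans_lt hT).ne
  obtain ⟨S, hS⟩ := hs
  suffices h : S = T by rwa [h] at hS
  refine HS.op_injective (ContinuousLinearMap.ext fun y => ext_inner_left ℂ fun x => ?_)
  have h1 := hS.mapL (innerSL ℂ (HS.ketBra x y))
  simp only [innerSL_apply_apply, HS.inner_ketBra] at h1
  have h2 := ((stdBasis K).hasSum_repr (Q y)).mapL (innerSL ℂ x ∘L U ∘L Q)
  have h3 : U (Q (Q y)) = T.op y := by
    rw [hQQ]; exact congrArg (fun A : K →L[ℂ] H => A y) hU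
  simp only [ContinuousLinearMap.comp_apply, innerSL_apply_apply, h3] at h2
  refine h1.unique (h2.congr_fun fun i => ?_)
  have h4 : inner ℂ (stdBasis K i) (Q y) = inner ℂ (b i) y := by
    rw [← ContinuousLinearMap.adjoint_inner_left, hQa]
  rw [HilbertBasis.repr_apply_apply, h4, map_smul, map_smul, HS.ketBra, HS.op_mk,
    InnerProductSpace.rankOne_apply]

/-- The trace norm is dual to the operator norm. -/
theorem traceNorm_le_of_inner_le {S : HS K H} {C : ℝ≥0∞}
    (h : ∀ R : HS K H, ‖R.op‖ ≤ 1 → ‖inner ℂ R S‖ₑ ≤ C) : traceNorm S.op ≤ C := by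
  obtain ⟨U, hU1, -, hU⟩ := exists_polar S.op
  have hpos : ∀ x, 0 ≤ (inner ℂ x (absOp S.op x)).re := fun x => by
    have := (ContinuousLinearMap.nonneg_iff_isPositive _).1 (absOp_nonneg S.op)
    exact this.re_inner_nonneg_right x
  refine ENNReal.summable.tsum_le_of_sum_le fun J => ?_
  -- The natural test operator `U` need not be Hilbert–Schmidt, so it is cut down to the span of
  -- finitely many basis vectors. Pairing with `S` then gives a partial sum of the trace: `∑ ⟪U eᵢ,
  -- S eᵢ⟫ = ∑ ⟪eᵢ, |S| eᵢ⟫`.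
  let R : HS K H := ∑ i ∈ J, HS.ketBra (U (stdBasis K i)) (stdBasis K i)
  have hR : ‖R.op‖ ≤ 1 := by
    refine ContinuousLinearMap.opNorm_le_bound _ zero_le_one fun x => ?_
    have h1 : R.op x = U (∑ i ∈ J, inner ℂ (stdBasis K i) x • stdBasis K i) := by
      simp [R, HS.ketBra]
    -- Bessel's inequality.
    have h2 : ‖∑ i ∈ J, inner ℂ (stdBasis K i) x • stdBasis K i‖ ≤ ‖x‖ := by
      refine (pow_le_pow_iff_left₀ (norm_nonneg _) (norm_nonneg _) two_ne_zero).1 ?_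
      refine le_trans (le_of_eq ?_) ((stdBasis K).orthonormal.sum_inner_products_le (s := J) x)
      rw [← inner_self_eq_norm_sq (𝕜 := ℂ), (stdBasis K).orthonormal.inner_sum]
      rw [map_sum]
      refine Finset.sum_congr rfl fun i _ => ?_
      rw [RCLike.conj_mul]
      norm_cast
    rw [h1]
    refine (U.le_opNorm _).trans ?_
    gcongr
  have hRS : ((∑ i ∈ J, (inner ℂ (stdBasis K i) (absOp S.op (stdBasis K i))).re : ℝ))
      ≤ ‖inner ℂ R S‖ := by
    refine le_trans (le_of_eq ?_) (Complex.re_le_norm _)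
    simp only [R, sum_inner, Complex.re_sum, HS.inner_ketBra]
    refine Finset.sum_congr rfl fun i _ => ?_
    rw [← ContinuousLinearMap.adjoint_inner_right, ← hU]
    rfl
  refine le_trans ?_ (h R hR)
  rw [← ENNReal.ofReal_sum_of_nonneg fun i _ => hpos _, ← ofReal_norm]
  exact ENNReal.ofReal_le_ofReal hRS

end Polar

/-! ### Double operator integrals of elementary tensors. -/

section ProductIntegral

variable {X Y : Type*} [MeasurableSpace X] [MeasurableSpace Y]
  {K H : Type*} [NormedAddCommGroup K] [InnerProductSpace ℂ K] [CompleteSpace K]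
  [NormedAddCommGroup H] [InnerProductSpace ℂ H] [CompleteSpace H]

theorem HS.sandwich_ketBra (A : H →L[ℂ] H) (B : K →L[ℂ] K) (x : H) (y : K) :
    HS.sandwich A B (HS.ketBra x y) = HS.ketBra (A x) (B.adjoint y) := by
  refine HS.op_injective (ContinuousLinearMap.ext fun z => ?_)
  simp [HS.ketBra, ContinuousLinearMap.adjoint_inner_left]

/-- On a rectangle both sides are `‖E(s) x‖² ‖F(t) y‖²`, and rectangles form a generating π-system
that contains the whole space. -/
theorem measure_prodPVM_ketBra (E : PVM X H) (F : PVM Y K) (x : H) (y : K) :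
    (prodPVM E F).measure (HS.ketBra x y) = (E.measure x).prod (F.measure y) := by
  have h : ∀ s t, MeasurableSet s → MeasurableSet t →
      (prodPVM E F).measure (HS.ketBra x y) (s ×ˢ t)
        = (E.measure x).prod (F.measure y) (s ×ˢ t) := by
    intro s t hs ht
    have h1 : (prodPVM E F).proj (s ×ˢ t) (HS.ketBra x y)
        = HS.ketBra (E.proj s x) (F.proj t y) := by
      refine HS.op_injective ((prodPVM_rect E F hs ht _).trans ?_)
      refine ContinuousLinearMap.ext fun z => ?_
      simp [HS.ketBra, inner_proj_left (F.isStarProjection t ht)]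
    rw [PVM.measure_apply _ _ (hs.prod ht), h1, HS.norm_ketBra, Measure.prod_prod,
      E.measure_apply x hs, F.measure_apply y ht, ENNReal.ofReal_mul (by positivity)]
  refine ext_of_generate_finite _ generateFrom_prod.symm isPiSystem_prod ?_ ?_
  · rintro _ ⟨s, hs, t, ht, rfl⟩
    exact h s t hs ht
  · rw [← Set.univ_prod_univ]
    exact h _ _ .univ .univ

theorem HS.ketBra_add_left (x x' : H) (y : K) :
    HS.ketBra (x + x') y = HS.ketBra x y + HS.ketBra x' y :=
  HS.op_injective (by simp [HS.ketBra])

theorem HS.ketBra_smul_left (c : ℂ) (x : H) (y : K) :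
    HS.ketBra (c • x) y = c • HS.ketBra x y :=
  HS.op_injective (by simp [HS.ketBra])

theorem HS.ketBra_add_right (x : H) (y y' : K) :
    HS.ketBra x (y + y') = HS.ketBra x y + HS.ketBra x y' :=
  HS.op_injective (by simp [HS.ketBra])

theorem HS.ketBra_smul_right (c : ℂ) (x : H) (y : K) :
    HS.ketBra x (c • y) = starRingEnd ℂ c • HS.ketBra x y :=
  HS.op_injective (by simp [HS.ketBra])

/-- Operators on `𝔖₂(K, H)` are determined by their diagonal values on rank-one operators. -/
theorem HS.ext_of_inner_ketBra {Φ Ψ : HS K H →L[ℂ] HS K H}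
    (h : ∀ x y, inner ℂ (HS.ketBra x y) (Φ (HS.ketBra x y))
      = inner ℂ (HS.ketBra x y) (Ψ (HS.ketBra x y))) : Φ = Ψ := by
  -- Polarization is applied once in each variable: first in `x` with `y` fixed, then in `y`. Since
  -- `|x⟩⟨y|` is conjugate-linear in `y`, the second form is made linear by taking the adjoint of
  -- the resulting operator.
  let L : (HS K H →L[ℂ] HS K H) → K → H →ₗ[ℂ] H := fun Θ y =>
    { toFun := fun x => (Θ (HS.ketBra x y)).op y
      map_add' := fun x x' => by simp [HS.ketBra_add_left]
      map_smul' := fun c x => by simp [HS.ketBra_smul_left] }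
  let M : (HS K H →L[ℂ] HS K H) → H → H → K →ₗ[ℂ] K := fun Θ x x' =>
    { toFun := fun y => (Θ (HS.ketBra x y)).op.adjoint x'
      map_add' := fun y y' => by simp [HS.ketBra_add_right]
      map_smul' := fun c y => by
        simp [HS.ketBra_smul_right, LinearIsometryEquiv.map_smulₛₗ] }
  have hL : ∀ y, L Φ y = L Ψ y := fun y => by
    rw [← ext_inner_map]
    intro x
    have h1 := h x y
    rw [HS.inner_ketBra, HS.inner_ketBra] at h1
    change inner ℂ ((Φ (HS.ketBra x y)).op y) x = inner ℂ ((Ψ (HS.ketBra x y)).op y) x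
    rw [← inner_conj_symm, h1, inner_conj_symm]
  have hM : ∀ x x', M Φ x x' = M Ψ x x' := fun x x' => by
    rw [← ext_inner_map]
    intro y
    have h1 : (Φ (HS.ketBra x y)).op y = (Ψ (HS.ketBra x y)).op y :=
      congrArg (fun A : H →ₗ[ℂ] H => A x) (hL y)
    change inner ℂ ((Φ (HS.ketBra x y)).op.adjoint x') y
      = inner ℂ ((Ψ (HS.ketBra x y)).op.adjoint x') y
    rw [ContinuousLinearMap.adjoint_inner_left, ContinuousLinearMap.adjoint_inner_left, h1]
  refine ContinuousLinearMap.ext_on (HS.dense_ketBra K H) ?_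
  rintro _ ⟨x, y, rfl⟩
  refine HS.op_injective (ContinuousLinearMap.adjoint.injective
    (ContinuousLinearMap.ext fun x' => ?_))
  exact congrArg (fun A : K →ₗ[ℂ] K => A y) (hM x x')

theorem exists_bound_mul {Ω Λ : Type*} {α : Ω → ℂ} {β : Λ → ℂ} (hα : ∃ C : ℝ, ∀ x, ‖α x‖ ≤ C)
    (hβ : ∃ C : ℝ, ∀ y, ‖β y‖ ≤ C) : ∃ C : ℝ, ∀ p : Ω × Λ, ‖α p.1 * β p.2‖ ≤ C := by
  obtain ⟨C, hC⟩ := hα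
  obtain ⟨D, hD⟩ := hβ
  refine ⟨C * D, fun p => ?_⟩
  rw [norm_mul]
  exact mul_le_mul (hC _) (hD _) (norm_nonneg _) ((norm_nonneg _).trans (hC p.1))

/-- On a rank-one operator the scalar measure of `𝒢` is a product measure, so the integral of the
tensor factors into `⟪x, A x⟫ ⟪y, B y⟫`. Diagonal values on rank-one operators determine the
operator. -/
theorem integral_prodPVM_mul (E : PVM X H) (F : PVM Y K) {α : X → ℂ} {β : Y → ℂ}
    (hα : Measurable α) (hβ : Measurable β) (hα' : ∃ C : ℝ, ∀ x, ‖α x‖ ≤ C)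
    (hβ' : ∃ C : ℝ, ∀ y, ‖β y‖ ≤ C) :
    (prodPVM E F).integral (fun p => α p.1 * β p.2)
      = HS.sandwich (E.integral α) (F.integral β) := by
  refine HS.ext_of_inner_ketBra fun x y => ?_
  have hm : Measurable fun p : X × Y => α p.1 * β p.2 :=
    (hα.comp measurable_fst).mul (hβ.comp measurable_snd)
  rw [PVM.inner_integral _ hm (exists_bound_mul hα' hβ'), measure_prodPVM_ketBra, integral_prod_mul,
    ← E.inner_integral hα hα', ← F.inner_integral hβ hβ', HS.inner_ketBra, HS.op_sandwich]
  simp [HS.ketBra, mul_comm]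

/-- Estimate for an elementary tensor applied to a rank-one operator. -/
theorem enorm_inner_integral_mul_le (E : PVM X H) (F : PVM Y K) {α : X → ℂ} {β : Y → ℂ}
    (hα : Measurable α) (hβ : Measurable β) (hα' : ∃ C : ℝ, ∀ x, ‖α x‖ ≤ C)
    (hβ' : ∃ C : ℝ, ∀ y, ‖β y‖ ≤ C) {R : HS K H} (hR : ‖R.op‖ ≤ 1) (a : H) (b : K) :
    ‖inner ℂ R ((prodPVM E F).integral (fun p => α p.1 * β p.2) (HS.ketBra a b))‖ₑ
      ≤ (‖a‖ₑ * ‖b‖ₑ) * (eLpNormEssSup α (E.measure a) * eLpNormEssSup β (F.measure b)) := by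
  set a' := E.integral α a
  set b' := (F.integral β).adjoint b with hb'
  have h1 : ‖a'‖ₑ ≤ eLpNormEssSup α (E.measure a) * ‖a‖ₑ := E.enorm_integral_le hα hα' a
  -- The adjoint of `∫ β dF` is the integral of the conjugate of `β`, which has the same essential
  -- supremum.
  have h2 : ‖b'‖ₑ ≤ eLpNormEssSup β (F.measure b) * ‖b‖ₑ := by
    have hm : Measurable fun y => starRingEnd ℂ (β y) :=
      Complex.continuous_conj.measurable.comp hβ
    rw [hb', F.adjoint_integral hβ hβ']
    refine (F.enorm_integral_le hm (by simpa using hβ') b).trans (le_of_eq ?_)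
    simp [eLpNormEssSup]
  -- The pairing of `R` with `|a'⟩⟨b'|` is the conjugate of `⟪a', R b'⟫`, so only the operator norm
  -- of `R` enters.
  have h3 : ‖inner ℂ R (HS.ketBra a' b')‖ₑ ≤ ‖a'‖ₑ * ‖b'‖ₑ := by
    rw [← inner_conj_symm, RCLike.enorm_conj, HS.inner_ketBra, ← ofReal_norm, ← ofReal_norm,
      ← ofReal_norm, ← ENNReal.ofReal_mul (norm_nonneg _)]
    refine ENNReal.ofReal_le_ofReal ((norm_inner_le_norm _ _).trans ?_)
    gcongr
    exact (R.op.le_opNorm _).trans (mul_le_of_le_one_left (norm_nonneg _) hR)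
  rw [integral_prodPVM_mul E F hα hβ hα' hβ', HS.sandwich_ketBra]
  refine (h3.trans (mul_le_mul' h1 h2)).trans (le_of_eq ?_)
  ring

end ProductIntegral

/-! ### Integration over the parameter space and the trace-norm bound. -/

section Main

variable {X : Type u₁} {Y : Type u₂} [MeasurableSpace X] [MeasurableSpace Y]
  {K : Type u₃} {H : Type u₄} [NormedAddCommGroup K] [InnerProductSpace ℂ K] [CompleteSpace K]
  [NormedAddCommGroup H] [InnerProductSpace ℂ H] [CompleteSpace H]

namespace Decomposition

variable {E : PVM X H} {F : PVM Y K} {φ : X × Y → ℂ} (d : Decomposition.{w} E F φ)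

theorem measurable_α_right (z : d.Z) : Measurable fun x => d.α (x, z) :=
  d.measurable_α.comp measurable_prodMk_right

theorem measurable_β_right (z : d.Z) : Measurable fun y => d.β (y, z) :=
  d.measurable_β.comp measurable_prodMk_right

theorem bounded_α_right (z : d.Z) : ∃ C : ℝ, ∀ x, ‖d.α (x, z)‖ ≤ C :=
  d.bounded_α.imp fun _ h x => h (x, z)

theorem bounded_β_right (z : d.Z) : ∃ C : ℝ, ∀ y, ‖d.β (y, z)‖ ≤ C :=
  d.bounded_β.imp fun _ h y => h (y, z)

/-- The elementary double operator integral of `α(·, z) ⊗ β(·, z)`. -/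
noncomputable def fiber (z : d.Z) : HS K H →L[ℂ] HS K H :=
  (prodPVM E F).integral fun p => d.α (p.1, z) * d.β (p.2, z)

/-- Fubini for the product of the finite measures `𝒢_{T,T}` and `ν`. The exceptional set of the
decomposition is null for every `𝒢_{T,T}`. Integrability is recorded because polarization needs
additivity of the integral. -/
theorem hasIntegral_inner_self (hφ : Measurable φ) (hb : ∃ C : ℝ, ∀ p, ‖φ p‖ ≤ C) (T : HS K H) :
    Integrable (fun z => inner ℂ T (d.fiber z T)) d.ν ∧
      inner ℂ T ((prodPVM E F).integral φ T) = ∫ z, inner ℂ T (d.fiber z T) ∂d.ν := by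
  have := d.isFiniteMeasure
  have hi : Integrable (fun q : (X × Y) × d.Z => d.α (q.1.1, q.2) * d.β (q.1.2, q.2))
      (((prodPVM E F).measure T).prod d.ν) := by
    obtain ⟨C, hC⟩ := d.bounded_α
    obtain ⟨D, hD⟩ := d.bounded_β
    refine Integrable.of_bound (Measurable.aestronglyMeasurable ?_) (C * D)
      (Eventually.of_forall fun q => ?_)
    · exact (d.measurable_α.comp (by fun_prop)).mul (d.measurable_β.comp (by fun_prop))
    · rw [norm_mul]
      exact mul_le_mul (hC _) (hD _) (norm_nonneg _) ((norm_nonneg _).trans (hC (q.1.1, q.2)))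
  have hz : ∀ z, inner ℂ T (d.fiber z T)
      = ∫ p, d.α (p.1, z) * d.β (p.2, z) ∂((prodPVM E F).measure T) := fun z =>
    PVM.inner_integral _ (((d.measurable_α_right z).comp measurable_fst).mul
      ((d.measurable_β_right z).comp measurable_snd))
      (exists_bound_mul (d.bounded_α_right z) (d.bounded_β_right z)) T
  simp only [hz]
  refine ⟨hi.integral_prod_right, ?_⟩
  rw [PVM.inner_integral _ hφ hb, ← integral_integral_swap hi]
  obtain ⟨s, hs, hs0, hst⟩ := d.ae_eq
  refine integral_congr_ae ?_
  have h0 : (prodPVM E F).measure T s = 0 := by rw [PVM.measure_apply _ T hs, hs0]; simp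
  filter_upwards [compl_mem_ae_iff.2 h0] with p hp
  exact hst p hp

theorem inner_integral_eq (hφ : Measurable φ) (hb : ∃ C : ℝ, ∀ p, ‖φ p‖ ≤ C) (R T : HS K H) :
    inner ℂ R ((prodPVM E F).integral φ T) = ∫ z, inner ℂ R (d.fiber z T) ∂d.ν := by
  have h := d.hasIntegral_inner_self hφ hb
  simp only [inner_polarization _ R T]
  rw [integral_div, integral_add, integral_sub, integral_sub, integral_const_mul,
    integral_const_mul, (h _).2, (h _).2, (h _).2, (h _).2]
  · exact (h _).1
  · exact (h _).1
  · exact (h _).1.sub (h _).1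
  · exact (h _).1.const_mul _
  · exact ((h _).1.sub (h _).1).sub ((h _).1.const_mul _)
  · exact (h _).1.const_mul _

/-- The quantity of which the norm of `𝔐` is the infimum. -/
noncomputable def bound : ℝ≥0∞ :=
  ⨆ (v : H) (u : K), ∫⁻ z, eLpNormEssSup (fun x => d.α (x, z)) (E.measure v)
      * eLpNormEssSup (fun y => d.β (y, z)) (F.measure u) ∂d.ν

theorem bound_lt_top : d.bound < ⊤ := by
  have := d.isFiniteMeasure
  obtain ⟨C, hC⟩ := d.bounded_α
  obtain ⟨D, hD⟩ := d.bounded_β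
  refine lt_of_le_of_lt (iSup₂_le fun v u => lintegral_mono (g := fun _ =>
    ENNReal.ofReal C * ENNReal.ofReal D) fun z => mul_le_mul' ?_ ?_) ?_
  · exact eLpNormEssSup_le_of_ae_bound (Eventually.of_forall fun x => hC (x, z))
  · exact eLpNormEssSup_le_of_ae_bound (Eventually.of_forall fun y => hD (y, z))
  · rw [lintegral_const]
    finiteness

/-- The integrand is estimated for this one pair `(a, b)` at every `z`, so the resulting integral is
one of the terms in the supremum defining `bound`. -/
theorem enorm_inner_integral_ketBra_le (hφ : Measurable φ) (hb : ∃ C : ℝ, ∀ p, ‖φ p‖ ≤ C)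
    {R : HS K H} (hR : ‖R.op‖ ≤ 1) (a : H) (b : K) :
    ‖inner ℂ R ((prodPVM E F).integral φ (HS.ketBra a b))‖ₑ ≤ d.bound * (‖a‖ₑ * ‖b‖ₑ) := by
  rw [d.inner_integral_eq hφ hb]
  refine (enorm_integral_le_lintegral_enorm _).trans ((lintegral_mono fun z =>
    enorm_inner_integral_mul_le E F (d.measurable_α_right z) (d.measurable_β_right z)
      (d.bounded_α_right z) (d.bounded_β_right z) hR a b).trans ?_)
  -- A finite constant leaves the lower integral without any measurability in `z` of the essential
  -- suprema.
  rw [lintegral_const_mul' _ _ (by finiteness), mul_comm]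
  gcongr
  exact le_iSup₂ (f := fun (v : H) (u : K) => ∫⁻ z, eLpNormEssSup (fun x => d.α (x, z))
    (E.measure v) * eLpNormEssSup (fun y => d.β (y, z)) (F.measure u) ∂d.ν) a b

theorem traceNorm_integral_le (hφ : Measurable φ) (hb : ∃ C : ℝ, ∀ p, ‖φ p‖ ≤ C)
    (T : HS K H) (hT : IsTraceClass T.op) :
    traceNorm ((prodPVM E F).integral φ T).op ≤ d.bound * traceNorm T.op := by
  obtain ⟨a, b, hab, hle⟩ := exists_hasSum_ketBra T hT
  refine traceNorm_le_of_inner_le fun R hR => ?_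
  -- The expansion converges in Hilbert–Schmidt norm, for which `∫ φ d𝒢` is bounded; it can
  -- therefore be paired with `R` term by term.
  have h1 := hab.mapL (innerSL ℂ R ∘L (prodPVM E F).integral φ)
  simp only [ContinuousLinearMap.comp_apply, innerSL_apply_apply] at h1
  rw [← h1.tsum_eq]
  refine (enorm_tsum_le_tsum_enorm).trans ?_
  refine le_trans ?_ (mul_le_mul_right hle d.bound)
  rw [← ENNReal.tsum_mul_left]
  exact ENNReal.tsum_le_tsum fun i => d.enorm_inner_integral_ketBra_le hφ hb hR _ _

end Decomposition

end Main

end DOI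

theorem mainTheorem7 {X : Type u₁} {Y : Type u₂} [MeasurableSpace X] [MeasurableSpace Y]
    {K : Type u₃} {H : Type u₄}
    [NormedAddCommGroup K] [InnerProductSpace ℂ K] [CompleteSpace K]
    [NormedAddCommGroup H] [InnerProductSpace ℂ H] [CompleteSpace H]
    (E : DOI.PVM X H) (F : DOI.PVM Y K) (φ : X × Y → ℂ)
    (hφ : DOI.MemM.{w, u₁, u₂, u₃, u₄} E F φ) :
    (∀ (T : K →L[ℂ] H) (hT : DOI.IsTraceClass T),
      DOI.IsTraceClass
        ((DOI.prodPVM E F).integral φ (DOI.HS.mk T hT.isHilbertSchmidt)).op) ∧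
    DOI.traceOpNorm ((DOI.prodPVM E F).integral φ) < ⊤ ∧
    DOI.traceOpNorm ((DOI.prodPVM E F).integral φ) ≤ DOI.normM.{w, u₁, u₂, u₃, u₄} E F φ := by
  obtain ⟨hm, hb, ⟨d₀⟩⟩ := hφ
  have hop : ∀ d : DOI.Decomposition.{w} E F φ,
      DOI.traceOpNorm ((DOI.prodPVM E F).integral φ) ≤ d.bound := fun d =>
    iSup₂_le fun T hT => (d.traceNorm_integral_le hm hb T (hT.trans_lt ENNReal.one_lt_top)).trans
      (mul_le_of_le_one_right' hT)
  -- One decomposition suffices for finiteness, because its bound is finite; the sharp estimate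
  -- takes the infimum over all of them.
  refine ⟨fun T hT => ?_, (hop d₀).trans_lt d₀.bound_lt_top, le_iInf hop⟩
  exact (d₀.traceNorm_integral_le hm hb (DOI.HS.mk T hT.isHilbertSchmidt) hT).trans_lt
    (ENNReal.mul_lt_top d₀.bound_lt_top hT)
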